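/- **Theorem.** A *multigraph* is a triple $(V,E,I)$ of a vertex set $V$, an edge set $E$ and an incidence relation $I$ such that every edge is incident with exactly two distinct vertices. For integers $k,l$, a *$(k,l)$-bipartite graph* is an $l$-regular multigraph whose vertices are coloured black and white, with exactly $k$ vertices of each colour, and in which every edge joins a black vertex to a white vertex. An *automorphism* of such a graph is a pair $(\varphi_V,\varphi_E)$, where $\varphi_V$ is a colour-preserving permutation of $V$ and $\varphi_E$ is a permutation of $E$, such that $(v,e)\in I$ if and only if $(\varphi_V(v),\varphi_E(e))\in I$. Let $\chi(k,l)$ and $\mu(k,l)$ be the minimum and the maximum of the order $|\mathrm{Aut}(\Gamma)|$ over all $(k,l)$-bipartite graphs $\Gamma$. Let $k\ge 8$ and $l\ge 2$ be integers and write $l=qk+r$ with $q,r$ integers and $-2\le r\le k-3$. Then $$\mu(k,l)=k!\,(l!)^k.$$ If $l=2$, then $\chi(k,l)=2k$. Otherwise $$\chi(k,l)=\begin{cases} (q+1)!^{\,k}\;q!^{\,k^2-2k}\;(q-1)!^{\,k} & \text{if } r=0,\\ (q+1)!^{\,rk}\;q!^{\,k^2-rk} & \text{if } 3\le r\le k-3,\\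 (q+r)!^{\,k+\lceil k/2\rceil}\;q!^{\,k^2-k-2\lceil k/2\rceil}\;(q-r)!^{\,\lceil k/2\rceil} & \text{if } r=\pm1,\\ (q+\varepsilon)!^{\,2k+1}\;q!^{\,k^2-2k-2}\;(q-\varepsilon)! & \text{if } r=2\varepsilon \text{ with } \varepsilon=\pm1, \end{cases}$$ where $n!^{\,m}$ means $(n!)^m$. -/

import Mathlib

open scoped Nat

/-- A multigraph with vertex set `V` and edge set `E`, given by an incidence relation for which
every edge is incident with exactly two distinct vertices, together with a colouring of its
vertices by two colours (`true` is black, `false` is white). Parallel edges are allowed. -/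
structure ColouredMultigraph (V E : Type) where
  inc : V → E → Prop
  exactly_two : ∀ e : E, ∃ u v : V, u ≠ v ∧ ∀ w : V, inc w e ↔ (w = u ∨ w = v)
  black : V → Bool

namespace ColouredMultigraph

variable {V E : Type}

/-- The automorphism group: pairs of a colour-preserving permutation of the vertices and a
permutation of the edges that together preserve incidence in both directions. -/
def aut (Γ : ColouredMultigraph V E) : Subgroup (Equiv.Perm V × Equiv.Perm E) where
  carrier := {f | (∀ v, Γ.black (f.1 v) = Γ.black v) ∧
    ∀ v e, Γ.inc v e ↔ Γ.inc (f.1 v) (f.2 e)}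
  one_mem' := ⟨fun _ => rfl, fun _ _ => Iff.rfl⟩
  mul_mem' := by
    rintro f g ⟨h1, h2⟩ ⟨h3, h4⟩
    exact ⟨fun v => (h1 (g.1 v)).trans (h3 v),
      fun v e => (h4 v e).trans (h2 (g.1 v) (g.2 e))⟩
  inv_mem' := by
    rintro f ⟨h1, h2⟩
    refine ⟨fun v => ?_, fun v e => ?_⟩
    · have h := h1 (f.1⁻¹ v)
      simpa using h.symm
    · have h := h2 (f.1⁻¹ v) (f.2⁻¹ e)
      simpa using h.symm

/-- `Γ` is a `(k, l)`-bipartite graph: both colour classes have exactly `k` vertices, the two ends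
of every edge have different colours, and every vertex is incident with exactly `l` edges.
(Cardinalities are taken in `ℕ∞`, so these classes and edge sets are finite.) -/
structure IsBipartiteRegular (Γ : ColouredMultigraph V E) (k l : ℕ) : Prop where
  card_black : {v | Γ.black v = true}.encard = k
  card_white : {v | Γ.black v = false}.encard = k
  bipartite : ∀ e u v, u ≠ v → Γ.inc u e → Γ.inc v e → Γ.black u ≠ Γ.black v
  regular : ∀ v, {e | Γ.inc v e}.encard = l

end ColouredMultigraph

/-- The set of orders of automorphism groups of `(k, l)`-bipartite graphs. -/
def autOrders (k l : ℕ) : Set ℕ :=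
  {n | ∃ (V E : Type) (Γ : ColouredMultigraph V E),
    Γ.IsBipartiteRegular k l ∧ n = Nat.card Γ.aut}

/-!
Number the black and the white vertices of a `(k, l)`-bipartite graph `Γ` by `Fin k`. Then `Γ` is
given by the matrix `A` of its edge multiplicities, whose row and column sums are all `l`, and an
automorphism is a pair of a row and a column permutation that preserves `A`, together with a choice
of how to map parallel edges. Hence `|Aut Γ| = |Sym A| * ∏ A i j !` (`mem_autOrders_iff`).

For the maximum, the black permutation and the edge permutation determine an automorphism; there
are `k !` of the former and, for each, `l ! ^ k` of the latter that cover it. Equality holds when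
`A` is `l` times the identity matrix (`isGreatest_autOrders`).

For the minimum, put `ε = ±1`, `l = q k + ε ρ` with `ρ ≥ 0`, and `B = ε (A - q)`, which has row and
column sums `ρ`. By log-convexity of the factorial (`prod_factorial_mul_pow_le`), `∏ A i j !` is
bounded below in terms of the sum of the negative parts of `B`, and each unit by which that sum is
lowered improves the product by a factor of at most `(q + 1) / q ≤ 2`. On the other hand a matrix
with few negative entries has symmetries: there is a number `t` such that `|Sym B| ≥ 2 ^ (t - s)`
when the negative parts of `B` add up to `s`. Here `t` is `k`, `(k + 1) / 2`, `1` and `0` for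
`ρ = 0`, `1`, `2` and `ρ ≥ 3`. For `ρ ≤ 1` almost all of these symmetries permute equal rows, equal
columns or isolated entries `1`; in the one configuration left over, the nonzero entries form
alternating closed walks that can be rotated (`exists_rotation`). For `ρ = 2` and `s = 0` the
symmetries are those of the cycles into which two perfect matchings combine. The two effects balance
(`le_mul_of_excess`): no matrix does better than one with `s = t`, entries of `B` in `{-1, 0, 1}`
and no symmetry. Such matrices exist for `k ≥ 8` (`HasAsymmetricMatrix`). They are modified cycles
and circulant bands, in which a symmetry has to fix some recognizable row or column and then,
step by step, everything else (`IsPatternSymm`).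

The degree `l = 2` is exceptional because there `q = 0`, so that no negative entry of `B` is
allowed. The graphs are then unions of cycles and double edges, each with at least `2 k`
automorphisms, and a single cycle has exactly `2 k` (`isLeast_autOrders_two`).
-/

/-! ### Symmetries of matrices and lifts of permutations -/

/-- The symmetry group of a matrix `A`: the pairs of a row permutation and a column permutation
that leave all entries of `A` in place. -/
def matrixSymm {ι κ α : Type*} (A : ι → κ → α) : Subgroup (Equiv.Perm ι × Equiv.Perm κ) where
  carrier := {p | ∀ i j, A (p.1 i) (p.2 j) = A i j}
  one_mem' := fun _ _ => rfl
  mul_mem' := fun {f g} hf hg i j => (hf (g.1 i) (g.2 j)).trans (hg i j)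
  inv_mem' := fun {f} hf i j => by simpa using (hf (f.1⁻¹ i) (f.2⁻¹ j)).symm

theorem mem_matrixSymm {ι κ α : Type*} {A : ι → κ → α} {p : Equiv.Perm ι × Equiv.Perm κ} :
    p ∈ matrixSymm A ↔ ∀ i j, A (p.1 i) (p.2 j) = A i j := Iff.rfl

theorem card_fiber_eq_of_lift {E P : Type*} {f : E → P} {s : Equiv.Perm P}
    {ψ : Equiv.Perm E} (hψ : ∀ e, f (ψ e) = s (f e)) (p : P) :
    Nat.card {e // f e = s p} = Nat.card {e // f e = p} :=
  (Nat.card_congr (ψ.subtypeEquiv fun e => by rw [hψ, s.apply_eq_iff_eq])).symm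

/-- The permutations of `E` that lift a given permutation `s` of the base of `f : E → P` form a
coset of the group of permutations that preserve every fibre of `f`. -/
theorem card_lift {E P : Type*} [Finite E] [Fintype P] (f : E → P) (s : Equiv.Perm P)
    (h : ∀ p, Nat.card {e // f e = s p} = Nat.card {e // f e = p}) :
    Nat.card {ψ : Equiv.Perm E // ∀ e, f (ψ e) = s (f e)} =
      ∏ p, (Nat.card {e // f e = p})! := by
  classical
  have := Fintype.ofFinite E
  have eq : ∀ c, Nonempty ({a // s (f a) = c} ≃ {b // f b = c}) := fun c => by
    rw [← Finite.card_eq,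
      Nat.card_congr (Equiv.subtypeEquivRight fun a => (Equiv.eq_symm_apply s).symm), ← h,
      Equiv.apply_symm_apply]
  let ψ₀ : Equiv.Perm E := Equiv.ofFiberEquiv fun c => (eq c).some
  have hψ₀ : ∀ a, f (ψ₀ a) = s (f a) := Equiv.ofFiberEquiv_map _
  have e1 : {ψ : Equiv.Perm E // ∀ e, f (ψ e) = s (f e)} ≃ {g : Equiv.Perm E // f ∘ g = f} :=
    ((Equiv.mulLeft ψ₀).subtypeEquiv fun g => by
      simp [funext_iff, hψ₀]).symm
  rw [Nat.card_congr e1, Nat.card_eq_fintype_card, DomMulAct.stabilizer_card]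
  simp [Nat.card_eq_fintype_card]

/-- Edge permutations together with the row and column permutations that they cover are counted by
the symmetries of the matrix of edge multiplicities, times the ways to permute parallel edges. -/
theorem card_liftTriples {ι κ E : Type*} [Fintype ι] [Fintype κ] [Finite E] (ends : E → ι × κ) :
    Nat.card {t : (Equiv.Perm ι × Equiv.Perm κ) × Equiv.Perm E //
        ∀ e, ends (t.2 e) = (t.1.1 (ends e).1, t.1.2 (ends e).2)} =
      Nat.card (matrixSymm fun i j => Nat.card {e // ends e = (i, j)}) *
        ∏ i, ∏ j, (Nat.card {e // ends e = (i, j)})! := by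
  classical
  have hfib : ∀ s : Equiv.Perm ι × Equiv.Perm κ,
      Nat.card {ψ : Equiv.Perm E // ∀ e, ends (ψ e) = (s.1 (ends e).1, s.2 (ends e).2)} =
        if s ∈ matrixSymm (fun i j => Nat.card {e // ends e = (i, j)}) then
          ∏ i, ∏ j, (Nat.card {e // ends e = (i, j)})! else 0 := by
    intro s
    split_ifs with h
    · rw [← Fintype.prod_prod_type', ← card_lift ends (s.1.prodCongr s.2) fun p => h p.1 p.2]
      rfl
    · rw [Nat.card_eq_zero]
      refine Or.inl ⟨fun ψ => h fun i j => ?_⟩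
      exact card_fiber_eq_of_lift (s := s.1.prodCongr s.2) ψ.2 (i, j)
  have e1 : {t : (Equiv.Perm ι × Equiv.Perm κ) × Equiv.Perm E //
        ∀ e, ends (t.2 e) = (t.1.1 (ends e).1, t.1.2 (ends e).2)} ≃
      Σ s : Equiv.Perm ι × Equiv.Perm κ,
        {ψ : Equiv.Perm E // ∀ e, ends (ψ e) = (s.1 (ends e).1, s.2 (ends e).2)} :=
    { toFun := fun t => ⟨t.1.1, t.1.2, t.2⟩
      invFun := fun t => ⟨(t.1, t.2.1), t.2.2⟩
      left_inv := fun _ => rfl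
      right_inv := fun _ => rfl }
  rw [Nat.card_congr e1, Nat.card_sigma, Finset.sum_congr rfl fun s _ => hfib s,
    Finset.sum_ite, Finset.sum_const_zero, add_zero, Finset.sum_const, smul_eq_mul]
  congr 1
  rw [Nat.card_eq_fintype_card, ← Fintype.card_subtype]

/-- The row permutation and the edge permutation determine the column permutation as soon as every
column meets an edge. -/
theorem card_liftTriples_le {ι κ E : Type*} [Fintype ι] [Fintype κ] [Finite E]
    (ends : E → ι × κ) (l : ℕ) (hl : ∀ i, Nat.card {e // (ends e).1 = i} = l)
    (hκ : ∀ j, ∃ e, (ends e).2 = j) :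
    Nat.card {t : (Equiv.Perm ι × Equiv.Perm κ) × Equiv.Perm E //
        ∀ e, ends (t.2 e) = (t.1.1 (ends e).1, t.1.2 (ends e).2)} ≤
      (Fintype.card ι)! * l ! ^ Fintype.card ι := by
  classical
  let F : {t : (Equiv.Perm ι × Equiv.Perm κ) × Equiv.Perm E //
        ∀ e, ends (t.2 e) = (t.1.1 (ends e).1, t.1.2 (ends e).2)} →
      Σ s : Equiv.Perm ι, {ψ : Equiv.Perm E // ∀ e, (ends (ψ e)).1 = s (ends e).1} :=
    fun t => ⟨t.1.1.1, t.1.2, fun e => by rw [t.2]⟩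
  have hF : Function.Injective F := by
    rintro ⟨⟨⟨σ, τ⟩, ψ⟩, h⟩ ⟨⟨⟨σ', τ'⟩, ψ'⟩, h'⟩ hh
    simp only [F, Sigma.mk.injEq] at hh
    obtain ⟨rfl, hh⟩ := hh
    simp only [heq_eq_eq, Subtype.mk.injEq] at hh
    subst hh
    have : τ = τ' := by
      ext j
      obtain ⟨e, rfl⟩ := hκ j
      have h1 := h e
      rw [h' e] at h1
      exact (congrArg Prod.snd h1).symm
    subst this
    rfl
  refine (Nat.card_le_card_of_injective F hF).trans ?_
  rw [Nat.card_sigma, Finset.sum_congr rfl fun s _ => card_lift (fun e => (ends e).1) s fun p => by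
    rw [hl, hl]]
  simp [hl, Fintype.card_perm]

/-! ### Graphs and matrices -/

/-- With a numbering of the two colour classes and the two ends of every edge, the automorphisms
are the triples of a black, a white and an edge permutation that are compatible with the ends. -/
theorem card_aut_eq_card_liftTriples {V E ι κ : Type} [Finite ι] [Finite κ]
    (Γ : ColouredMultigraph V E) (v : ι ⊕ κ ≃ V) (ends : E → ι × κ)
    (hb : ∀ i, Γ.black (v (Sum.inl i)) = true) (hw : ∀ j, Γ.black (v (Sum.inr j)) = false)
    (hib : ∀ i e, Γ.inc (v (Sum.inl i)) e ↔ (ends e).1 = i)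
    (hiw : ∀ j e, Γ.inc (v (Sum.inr j)) e ↔ (ends e).2 = j) :
    Nat.card Γ.aut = Nat.card {t : (Equiv.Perm ι × Equiv.Perm κ) × Equiv.Perm E //
        ∀ e, ends (t.2 e) = (t.1.1 (ends e).1, t.1.2 (ends e).2)} := by
  symm
  let F : {t : (Equiv.Perm ι × Equiv.Perm κ) × Equiv.Perm E //
        ∀ e, ends (t.2 e) = (t.1.1 (ends e).1, t.1.2 (ends e).2)} → Γ.aut := fun t =>
    ⟨(v.permCongr (Equiv.Perm.sumCongr t.1.1.1 t.1.1.2), t.1.2), by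
      refine ⟨fun x => ?_, fun x e => ?_⟩
      · obtain ⟨y, rfl⟩ := v.surjective x
        rcases y with i | j <;> simp [hb, hw]
      · obtain ⟨y, rfl⟩ := v.surjective x
        rcases y with i | j <;> simp [hib, hiw, t.2]⟩
  refine Nat.card_eq_of_bijective F ⟨?_, ?_⟩
  · rintro ⟨⟨⟨σ, τ⟩, ψ⟩, h⟩ ⟨⟨⟨σ', τ'⟩, ψ'⟩, h'⟩ hh
    have h1 := congrArg (fun x => x.1.1) hh
    obtain rfl : ψ = ψ' := congrArg (fun x => x.1.2) hh
    have h2 := v.permCongr.injective h1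
    have h3 := Equiv.Perm.sumCongrHom_injective (a₁ := (σ, τ)) (a₂ := (σ', τ')) h2
    simp only [Prod.mk.injEq] at h3
    obtain ⟨rfl, rfl⟩ := h3
    rfl
  · rintro ⟨⟨θ, ψ⟩, hθ, hψ⟩
    dsimp only at hθ hψ
    have hm : v.symm.permCongr θ ∈ (Equiv.Perm.sumCongrHom ι κ).range := by
      apply Equiv.Perm.mem_sumCongrHom_range_of_perm_mapsTo_inl
      rintro _ ⟨i, rfl⟩
      rcases h : v.symm.permCongr θ (Sum.inl i) with i' | j'
      · exact ⟨i', rfl⟩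
      · have h1 : θ (v (Sum.inl i)) = v (Sum.inr j') := by
          rw [← h]; simp
        have h2 := hθ (v (Sum.inl i))
        rw [h1, hw, hb] at h2
        exact absurd h2 (by simp)
    obtain ⟨⟨σ, τ⟩, hst⟩ := hm
    have hst' : ∀ y, θ (v y) = v (Equiv.Perm.sumCongr σ τ y) := fun y => by
      have := congrArg (fun p => v (p y)) hst
      simpa using this.symm
    refine ⟨⟨((σ, τ), ψ), fun e => ?_⟩, ?_⟩
    · have h1 := (hψ (v (Sum.inl (ends e).1)) e).1 ((hib _ _).2 rfl)
      have h2 := (hψ (v (Sum.inr (ends e).2)) e).1 ((hiw _ _).2 rfl)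
      rw [hst'] at h1 h2
      exact Prod.ext ((hib _ _).1 h1) ((hiw _ _).1 h2)
    · apply Subtype.ext
      refine Prod.ext (Equiv.ext fun x => ?_) rfl
      obtain ⟨y, rfl⟩ := v.surjective x
      simp [F, hst']

/-- A `(k, l)`-bipartite graph is encoded by its ends map once the colour classes are numbered. -/
theorem exists_ends_of_isBipartiteRegular {V E : Type} {Γ : ColouredMultigraph V E} {k l : ℕ}
    (h : Γ.IsBipartiteRegular k l) :
    Finite E ∧ ∃ ends : E → Fin k × Fin k,
      (∀ i, Nat.card {e // (ends e).1 = i} = l) ∧ (∀ j, Nat.card {e // (ends e).2 = j} = l) ∧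
      Nat.card Γ.aut = Nat.card {t : (Equiv.Perm (Fin k) × Equiv.Perm (Fin k)) × Equiv.Perm E //
        ∀ e, ends (t.2 e) = (t.1.1 (ends e).1, t.1.2 (ends e).2)} := by
  classical
  obtain ⟨hcb, hcw, hbip, hreg⟩ := h
  have fb : Finite {v | Γ.black v = true} :=
    Set.finite_coe_iff.2 (Set.finite_of_encard_eq_coe hcb)
  have fw : Finite {v | Γ.black v = false} :=
    Set.finite_coe_iff.2 (Set.finite_of_encard_eq_coe hcw)
  have nb : Nat.card {v | Γ.black v = true} = k := by
    rw [Nat.card_coe_set_eq, Set.ncard, hcb, ENat.toNat_natCast]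
  have nw : Nat.card {v | Γ.black v = false} = k := by
    rw [Nat.card_coe_set_eq, Set.ncard, hcw, ENat.toNat_natCast]
  let eb : Fin k ≃ {v | Γ.black v = true} := (Finite.equivFinOfCardEq nb).symm
  let ew : Fin k ≃ {v | Γ.black v = false} := (Finite.equivFinOfCardEq nw).symm
  let v0 : Fin k ⊕ Fin k → V := Sum.elim (fun i => (eb i : V)) (fun j => (ew j : V))
  have hv0b : ∀ i, Γ.black (v0 (Sum.inl i)) = true := fun i => (eb i).2
  have hv0w : ∀ j, Γ.black (v0 (Sum.inr j)) = false := fun j => (ew j).2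
  have hv0 : Function.Bijective v0 := by
    constructor
    · rintro (i | j) (i' | j') hh
      · simpa [v0, Subtype.coe_inj] using hh
      · have := hv0b i; rw [hh, hv0w] at this; simp at this
      · have := hv0b i'; rw [← hh, hv0w] at this; simp at this
      · simpa [v0, Subtype.coe_inj] using hh
    · intro x
      cases hx : Γ.black x
      · exact ⟨Sum.inr (ew.symm ⟨x, hx⟩), by simp [v0]⟩
      · exact ⟨Sum.inl (eb.symm ⟨x, hx⟩), by simp [v0]⟩
  let v : Fin k ⊕ Fin k ≃ V := Equiv.ofBijective v0 hv0
  have hvb : ∀ i, Γ.black (v (Sum.inl i)) = true := hv0b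
  have hvw : ∀ j, Γ.black (v (Sum.inr j)) = false := hv0w
  have hends : ∀ e, ∃ p : Fin k × Fin k, (∀ i, Γ.inc (v (Sum.inl i)) e ↔ p.1 = i) ∧
      (∀ j, Γ.inc (v (Sum.inr j)) e ↔ p.2 = j) := by
    intro e
    obtain ⟨x, y, hxy, he⟩ := Γ.exactly_two e
    have hc := hbip e x y hxy ((he x).2 (Or.inl rfl)) ((he y).2 (Or.inr rfl))
    obtain ⟨a, rfl⟩ := v.surjective x
    obtain ⟨b, rfl⟩ := v.surjective y
    rcases a with i | j <;> rcases b with i' | j'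
    · simp [hvb] at hc
    · exact ⟨(i, j'), fun i₁ => by simp [he, eq_comm], fun j₁ => by simp [he, eq_comm]⟩
    · exact ⟨(i', j), fun i₁ => by simp [he, eq_comm], fun j₁ => by simp [he, eq_comm]⟩
    · simp [hvw] at hc
  choose ends hib hiw using hends
  have hfin : ∀ x, Set.Finite {e | Γ.inc x e} := fun x => Set.finite_of_encard_eq_coe (hreg x)
  have fE : Finite E := by
    have : Finite V := Finite.of_equiv _ v
    refine Set.finite_univ_iff.1 ((Set.finite_iUnion hfin).subset fun e _ => ?_)
    exact Set.mem_iUnion.2 ⟨v (Sum.inl (ends e).1), (hib e _).2 rfl⟩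
  have hcard : ∀ x, Nat.card {e // Γ.inc x e} = l := fun x => by
    change Nat.card ↥{e | Γ.inc x e} = l
    rw [Nat.card_coe_set_eq, Set.ncard, hreg, ENat.toNat_natCast]
  refine ⟨fE, ends, fun i => ?_, fun j => ?_, ?_⟩
  · rw [← hcard (v (Sum.inl i))]
    exact Nat.card_congr (Equiv.subtypeEquivRight fun e => (hib e i).symm)
  · rw [← hcard (v (Sum.inr j))]
    exact Nat.card_congr (Equiv.subtypeEquivRight fun e => (hiw e j).symm)
  · exact card_aut_eq_card_liftTriples Γ v ends hvb hvw (fun i e => hib e i) (fun j e => hiw e j)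

theorem card_fst_eq_sum {ι κ E : Type*} [Fintype κ] [Finite E] (ends : E → ι × κ) (i : ι) :
    ∑ j, Nat.card {e // ends e = (i, j)} = Nat.card {e // (ends e).1 = i} := by
  rw [← Nat.card_sigma]
  exact Nat.card_congr
    { toFun := fun x => ⟨x.2.1, by rw [x.2.2]⟩
      invFun := fun x => ⟨(ends x.1).2, x.1, Prod.ext x.2 rfl⟩
      left_inv := by
        rintro ⟨j, e, he⟩
        obtain rfl : j = (ends e).2 := by rw [he]
        rfl
      right_inv := fun _ => rfl }

theorem card_snd_eq_sum {ι κ E : Type*} [Fintype ι] [Finite E] (ends : E → ι × κ) (j : κ) :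
    ∑ i, Nat.card {e // ends e = (i, j)} = Nat.card {e // (ends e).2 = j} := by
  rw [← Nat.card_sigma]
  exact Nat.card_congr
    { toFun := fun x => ⟨x.2.1, by rw [x.2.2]⟩
      invFun := fun x => ⟨(ends x.1).1, x.1, Prod.ext rfl x.2⟩
      left_inv := by
        rintro ⟨i, e, he⟩
        obtain rfl : i = (ends e).1 := by rw [he]
        rfl
      right_inv := fun _ => rfl }

/-- The bipartite multigraph with `A i j` parallel edges between the black vertex `i` and the white
vertex `j`. -/
def graphOfMatrix {k : ℕ} (A : Fin k → Fin k → ℕ) :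
    ColouredMultigraph (Fin k ⊕ Fin k) (Σ p : Fin k × Fin k, Fin (A p.1 p.2)) where
  inc v e := v = Sum.inl e.1.1 ∨ v = Sum.inr e.1.2
  exactly_two e := ⟨Sum.inl e.1.1, Sum.inr e.1.2, by simp, fun _ => Iff.rfl⟩
  black v := v.isLeft

theorem card_end_eq {k : ℕ} (A : Fin k → Fin k → ℕ) (i j : Fin k) :
    Nat.card {e : Σ p : Fin k × Fin k, Fin (A p.1 p.2) // e.1 = (i, j)} = A i j := by
  rw [Nat.card_congr (Equiv.sigmaSubtype (i, j)), Nat.card_eq_fintype_card, Fintype.card_fin]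

/-- The orders of automorphism groups of `(k, l)`-bipartite graphs in terms of nonnegative integer
matrices with all row and column sums equal to `l`. -/
theorem mem_autOrders_iff {k l n : ℕ} :
    n ∈ autOrders k l ↔ ∃ A : Fin k → Fin k → ℕ, (∀ i, ∑ j, A i j = l) ∧ (∀ j, ∑ i, A i j = l) ∧
      n = Nat.card (matrixSymm A) * ∏ i, ∏ j, (A i j)! := by
  constructor
  · rintro ⟨V, E, Γ, h, rfl⟩
    obtain ⟨_, ends, h1, h2, h3⟩ := exists_ends_of_isBipartiteRegular h
    refine ⟨fun i j => Nat.card {e // ends e = (i, j)}, fun i => ?_, fun j => ?_, ?_⟩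
    · rw [card_fst_eq_sum, h1]
    · rw [card_snd_eq_sum, h2]
    · rw [h3, card_liftTriples]
  · rintro ⟨A, h1, h2, rfl⟩
    refine ⟨_, _, graphOfMatrix A, ⟨?_, ?_, ?_, ?_⟩, ?_⟩
    · have : {v : Fin k ⊕ Fin k | (graphOfMatrix A).black v = true} = Set.range Sum.inl := by
        ext (i | j) <;> simp [graphOfMatrix]
      rw [this, ← Set.image_univ, Sum.inl_injective.encard_image]
      simp
    · have : {v : Fin k ⊕ Fin k | (graphOfMatrix A).black v = false} = Set.range Sum.inr := by
        ext (i | j) <;> simp [graphOfMatrix]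
      rw [this, ← Set.image_univ, Sum.inr_injective.encard_image]
      simp
    · rintro e u v huv (rfl | rfl) (rfl | rfl) <;> simp_all [graphOfMatrix]
    · have key : ∀ s : Set (Σ p : Fin k × Fin k, Fin (A p.1 p.2)), Nat.card s = l →
          s.encard = l := fun s hs => by
        rw [← hs, Nat.card_coe_set_eq, (Set.toFinite s).cast_ncard_eq]
      rintro (i | j)
      · apply key
        rw [← h1 i, Finset.sum_congr rfl fun j _ => (card_end_eq A i j).symm, card_fst_eq_sum]
        exact Nat.card_congr (Equiv.subtypeEquivRight fun e => by simp [graphOfMatrix, eq_comm])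
      · apply key
        rw [← h2 j, Finset.sum_congr rfl fun i _ => (card_end_eq A i j).symm, card_snd_eq_sum]
        exact Nat.card_congr (Equiv.subtypeEquivRight fun e => by simp [graphOfMatrix, eq_comm])
    · rw [card_aut_eq_card_liftTriples (graphOfMatrix A) (Equiv.refl _) (fun e => e.1)
        (by simp [graphOfMatrix]) (by simp [graphOfMatrix])
        (by simp [graphOfMatrix, eq_comm]) (by simp [graphOfMatrix, eq_comm]), card_liftTriples]
      simp only [card_end_eq]

/-! ### The maximum -/

theorem card_matrixSymm_diagonal {k l : ℕ} (hl : l ≠ 0) :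
    Nat.card (matrixSymm fun i j : Fin k => if i = j then l else 0) = k ! := by
  have e : Equiv.Perm (Fin k) ≃ matrixSymm fun i j : Fin k => if i = j then l else 0 :=
    { toFun := fun σ => ⟨(σ, σ), fun i j => by simp⟩
      invFun := fun p => p.1.1
      left_inv := fun _ => rfl
      right_inv := by
        rintro ⟨⟨σ, τ⟩, h⟩
        have : τ = σ := by
          ext i
          have := h i i
          simp only [if_true] at this
          rw [eq_comm]
          by_contra hne
          rw [if_neg fun h' => hne (congrArg _ h')] at this
          exact hl this.symm
        subst this
        rfl }
  rw [← Nat.card_congr e, Nat.card_perm, Nat.card_eq_fintype_card, Fintype.card_fin]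

theorem isGreatest_autOrders {k l : ℕ} (hl : l ≠ 0) :
    IsGreatest (autOrders k l) (k ! * l ! ^ k) := by
  constructor
  · rw [mem_autOrders_iff]
    refine ⟨fun i j => if i = j then l else 0, by simp, by simp, ?_⟩
    rw [card_matrixSymm_diagonal hl]
    have : ∀ i : Fin k, ∏ j : Fin k, (if i = j then l else 0)! = l ! := fun i => by
      rw [Finset.prod_eq_single i] <;> simp +contextual [eq_comm]
    simp [this]
  · rintro n ⟨V, E, Γ, h, rfl⟩
    obtain ⟨_, ends, h1, h2, h3⟩ := exists_ends_of_isBipartiteRegular h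
    rw [h3]
    simpa using card_liftTriples_le ends l h1 fun j => by
      have : Nat.card {e // (ends e).2 = j} ≠ 0 := by rw [h2]; exact hl
      obtain ⟨⟨e, he⟩⟩ := (Nat.card_ne_zero.1 this).1
      exact ⟨e, he⟩

/-! ### Lower bounds for symmetry groups -/

/-- Permuting the elements of each fibre of `f` freely gives `∏ nᵢ! ≥ ∏ 2 ^ (nᵢ - 1)`
permutations. -/
theorem two_pow_le_card_preserving {ι α : Type*} [Fintype ι] [DecidableEq α] (f : ι → α) :
    2 ^ (Fintype.card ι - (Finset.univ.image f).card) ≤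
      Nat.card {g : Equiv.Perm ι // f ∘ g = f} := by
  classical
  have h1 : Fintype.card ι = ∑ a ∈ Finset.univ.image f, Fintype.card {i // f i = a} := by
    rw [← Finset.card_univ, Finset.card_eq_sum_card_image f]
    exact Finset.sum_congr rfl fun a _ => by rw [Fintype.card_subtype]
  have h2 : ∀ a ∈ Finset.univ.image f, 1 ≤ Fintype.card {i // f i = a} := by
    intro a ha
    obtain ⟨i, _, rfl⟩ := Finset.mem_image.1 ha
    exact Fintype.card_pos_iff.2 ⟨i, rfl⟩
  have h3 : Fintype.card ι - (Finset.univ.image f).card =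
      ∑ a ∈ Finset.univ.image f, (Fintype.card {i // f i = a} - 1) := by
    rw [Finset.sum_tsub_distrib _ h2, ← h1, Finset.card_eq_sum_ones]
  rw [Nat.card_eq_fintype_card, DomMulAct.stabilizer_card', h3, ← Finset.prod_pow_eq_pow_sum]
  refine Finset.prod_le_prod' fun a ha => ?_
  have h4 := Nat.factorial_mul_pow_le_factorial (m := 1) (n := Fintype.card {i // f i = a} - 1)
  rwa [Nat.add_sub_cancel' (h2 a ha), Nat.factorial_one, one_mul] at h4

/-- If every row permutation preserving `f` extends to a symmetry, then these extensions can be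
combined freely with the permutations of equal columns. -/
theorem card_preserving_mul_le {ι κ α β : Type*} [Finite ι] [Finite κ] (A : ι → κ → α) (f : ι → β)
    (h : ∀ σ : Equiv.Perm ι, f ∘ σ = f → ∃ τ : Equiv.Perm κ, (σ, τ) ∈ matrixSymm A) :
    Nat.card {σ : Equiv.Perm ι // f ∘ σ = f} *
      Nat.card {τ : Equiv.Perm κ // (fun j i => A i j) ∘ τ = fun j i => A i j} ≤
      Nat.card (matrixSymm A) := by
  choose τ₀ hτ₀ using fun σ : {σ : Equiv.Perm ι // f ∘ σ = f} => h σ.1 σ.2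
  rw [← Nat.card_prod]
  refine Nat.card_le_card_of_injective
    (fun x => (⟨(x.1.1, τ₀ x.1 * x.2.1), fun i j => ?_⟩ : matrixSymm A)) ?_
  · have h1 := hτ₀ x.1 i (x.2.1 j)
    have h2 := congrFun (congrFun x.2.2 j) i
    exact h1.trans h2
  · rintro ⟨σ, τ⟩ ⟨σ', τ'⟩ hh
    have h1 := congrArg (fun x => x.1.1) hh
    have h2 := congrArg (fun x => x.1.2) hh
    obtain rfl : σ = σ' := Subtype.ext h1
    obtain rfl : τ = τ' := Subtype.ext (mul_left_cancel h2)
    rfl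

/-- Equal rows and equal columns can be permuted freely. -/
theorem two_pow_twins_le_card {ι κ α : Type*} [Fintype ι] [Fintype κ] [DecidableEq α]
    (A : ι → κ → α) :
    2 ^ ((Fintype.card ι - (Finset.univ.image A).card) +
        (Fintype.card κ - (Finset.univ.image fun j i => A i j).card)) ≤
      Nat.card (matrixSymm A) := by
  rw [pow_add]
  refine (Nat.mul_le_mul (two_pow_le_card_preserving A) (two_pow_le_card_preserving _)).trans
    (card_preserving_mul_le A A fun σ hσ => ⟨1, fun i j => ?_⟩)
  exact congrFun (congrFun hσ i) j

theorem two_le_card_of_ne_one {G : Type*} [Group G] [Finite G] {H : Subgroup G} {g : G}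
    (hg : g ∈ H) (h1 : g ≠ 1) : 2 ≤ Nat.card H := by
  have : Nontrivial H := ⟨⟨⟨g, hg⟩, 1, fun h => h1 (congrArg Subtype.val h)⟩⟩
  exact Finite.one_lt_card

/-! ### Factorial products -/

theorem factorial_mul_pow_le (q n : ℕ) : q ! * (q + 1) ^ (n - q) ≤ n ! * q ^ (q - n) := by
  rcases le_total q n with h | h
  · obtain ⟨d, rfl⟩ := Nat.exists_eq_add_of_le h
    simpa using Nat.factorial_mul_pow_le_factorial (m := q) (n := d)
  · obtain ⟨d, rfl⟩ := Nat.exists_eq_add_of_le h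
    simp only [Nat.sub_eq_zero_of_le h, pow_zero, mul_one, Nat.add_sub_cancel_left]
    rw [← Nat.factorial_mul_ascFactorial]
    exact Nat.mul_le_mul_left _ (Nat.ascFactorial_le_pow_add n d)

theorem prod_factorial_mul_pow_le {k : ℕ} (q : ℕ) (A : Fin k → Fin k → ℕ) :
    q ! ^ k ^ 2 * (q + 1) ^ (∑ i, ∑ j, (A i j - q)) ≤
      (∏ i, ∏ j, (A i j)!) * q ^ (∑ i, ∑ j, (q - A i j)) := by
  have h : ∏ i : Fin k, ∏ j : Fin k, (q ! * (q + 1) ^ (A i j - q)) ≤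
      ∏ i : Fin k, ∏ j : Fin k, ((A i j)! * q ^ (q - A i j)) :=
    Finset.prod_le_prod' fun i _ => Finset.prod_le_prod' fun j _ => factorial_mul_pow_le q (A i j)
  simpa [Finset.prod_mul_distrib, Finset.prod_pow_eq_pow_sum, pow_mul, sq] using h

/-- Comparing a matrix with total excess `p` and total deficiency `m` over `q` to the reference
values `p₀` and `m₀`: each unit of excess that is saved costs a factor `2 ≥ (q + 1) / q` in the
number of symmetries. -/
theorem le_mul_of_excess {q n p m p₀ m₀ a P T : ℕ} (hq : q ≠ 0)
    (hT : T * q ^ m₀ = q ! ^ n * (q + 1) ^ p₀) (hP : q ! ^ n * (q + 1) ^ p ≤ P * q ^ m)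
    (hpm : p + m₀ = p₀ + m) (ha : 2 ^ (p₀ - p) ≤ a) : T ≤ a * P := by
  have hq0 : 0 < q := Nat.pos_of_ne_zero hq
  rcases le_total p₀ p with h | h
  · obtain ⟨d, rfl⟩ := Nat.exists_eq_add_of_le h
    obtain rfl : m = m₀ + d := by omega
    have ha1 : 1 ≤ a := le_trans Nat.one_le_two_pow ha
    refine le_trans ?_ (Nat.le_mul_of_pos_left P ha1)
    refine Nat.le_of_mul_le_mul_right (c := q ^ (m₀ + d)) ?_ (by positivity)
    refine le_trans ?_ hP
    rw [pow_add, ← mul_assoc, hT, pow_add, ← mul_assoc]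
    exact Nat.mul_le_mul_left _ (Nat.pow_le_pow_left (Nat.le_succ q) d)
  · obtain ⟨d, rfl⟩ := Nat.exists_eq_add_of_le h
    obtain rfl : m₀ = m + d := by omega
    rw [Nat.add_sub_cancel_left] at ha
    refine Nat.le_of_mul_le_mul_right (c := q ^ (m + d)) ?_ (by positivity)
    calc T * q ^ (m + d) = q ! ^ n * (q + 1) ^ p * (q + 1) ^ d := by rw [hT, pow_add, mul_assoc]
      _ ≤ P * q ^ m * (2 * q) ^ d :=
        Nat.mul_le_mul hP (Nat.pow_le_pow_left (by omega) d)
      _ = 2 ^ d * P * q ^ (m + d) := by ring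
      _ ≤ a * P * q ^ (m + d) := by gcongr

/-! ### Matrices with all row and column sums equal to two -/

theorem exists_eq_ite_of_sum_eq_one {ι : Type*} [Fintype ι] [DecidableEq ι] {f : ι → ℕ}
    (h : ∑ i, f i = 1) : ∃ i, ∀ j, f j = if j = i then 1 else 0 := by
  obtain ⟨i, _, hi⟩ : ∃ i ∈ Finset.univ, f i ≠ 0 :=
    Finset.exists_ne_zero_of_sum_ne_zero (by rw [h]; exact one_ne_zero)
  have h2 := Finset.add_sum_erase Finset.univ f (Finset.mem_univ i)
  rw [h] at h2
  refine ⟨i, fun j => ?_⟩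
  split_ifs with hj
  · subst hj; omega
  · have h3 : ∑ x ∈ Finset.univ.erase i, f x = 0 := by omega
    exact Finset.sum_eq_zero_iff.1 h3 j (by simp [hj])

theorem exists_perm_of_sum_eq_one {k : ℕ} (A : Fin k → Fin k → ℕ) (hr : ∀ i, ∑ j, A i j = 1)
    (hc : ∀ j, ∑ i, A i j = 1) :
    ∃ w : Equiv.Perm (Fin k), ∀ i j, A i j = if j = w i then 1 else 0 := by
  choose g hg using fun i => exists_eq_ite_of_sum_eq_one (hr i)
  have hginj : Function.Injective g := by
    intro i i' h
    obtain ⟨a, ha⟩ := exists_eq_ite_of_sum_eq_one (hc (g i))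
    have h1 := ha i
    have h2 := ha i'
    rw [hg, if_pos rfl] at h1
    rw [hg, if_pos h] at h2
    have h3 : i = a := by by_contra hne; simp [hne] at h1
    have h4 : i' = a := by by_contra hne; simp [hne] at h2
    rw [h3, h4]
  exact ⟨Equiv.ofBijective g (Finite.injective_iff_bijective.1 hginj), hg⟩

/-- Hall's theorem splits a nonnegative integer matrix with row and column sums `2` into two
permutation matrices. -/
theorem exists_perm_add_perm {k : ℕ} (A : Fin k → Fin k → ℕ) (hr : ∀ i, ∑ j, A i j = 2)
    (hc : ∀ j, ∑ i, A i j = 2) :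
    ∃ u w : Equiv.Perm (Fin k), ∀ i j,
      A i j = (if j = u i then 1 else 0) + (if j = w i then 1 else 0) := by
  classical
  have hall : ∃ f : Fin k → Fin k, Function.Injective f ∧
      ∀ i, f i ∈ (Finset.univ.filter fun j => A i j ≠ 0) := by
    rw [← Finset.all_card_le_biUnion_card_iff_exists_injective]
    intro s
    set N := s.biUnion fun i => Finset.univ.filter fun j => A i j ≠ 0
    have h1 : s.card * 2 = ∑ i ∈ s, ∑ j ∈ N, A i j := by
      rw [← smul_eq_mul, ← Finset.sum_const]
      refine Finset.sum_congr rfl fun i hi => ?_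
      rw [← hr i]
      symm
      refine Finset.sum_subset (Finset.subset_univ _) fun j _ hj => ?_
      by_contra h
      exact hj (Finset.mem_biUnion.2 ⟨i, hi, by simpa using h⟩)
    have h2 : ∑ i ∈ s, ∑ j ∈ N, A i j ≤ N.card * 2 := by
      rw [Finset.sum_comm, ← smul_eq_mul, ← Finset.sum_const]
      refine Finset.sum_le_sum fun j _ => ?_
      rw [← hc j]
      exact Finset.sum_le_sum_of_subset (Finset.subset_univ _)
    omega
  obtain ⟨f, hf, hfA⟩ := hall
  let u : Equiv.Perm (Fin k) := Equiv.ofBijective f (Finite.injective_iff_bijective.1 hf)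
  have hu : ∀ i, 1 ≤ A i (u i) := fun i => Nat.one_le_iff_ne_zero.2 (Finset.mem_filter.1 (hfA i)).2
  have hle : ∀ i j, (if j = u i then 1 else 0) ≤ A i j := fun i j => by
    split_ifs with h
    · rw [h]; exact hu i
    · exact Nat.zero_le _
  have hrow : ∀ i, ∑ j, (A i j - if j = u i then 1 else 0) = 1 := fun i => by
    rw [Finset.sum_tsub_distrib _ fun j _ => hle i j, hr]; simp
  have hcol : ∀ j, ∑ i, (A i j - if j = u i then 1 else 0) = 1 := fun j => by
    rw [Finset.sum_tsub_distrib _ fun i _ => hle i j, hc]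
    have : ∀ i, (j = u i) = (i = u.symm j) := fun i =>
      propext ⟨fun h => by simp [h], fun h => by simp [h]⟩
    simp [this]
  obtain ⟨w, hw⟩ := exists_perm_of_sum_eq_one _ hrow hcol
  refine ⟨u, w, fun i j => ?_⟩
  rw [← hw i j]
  exact (Nat.add_sub_cancel' (hle i j)).symm

section TwoPerms

variable {k : ℕ} {A : Fin k → Fin k → ℕ} {u w : Equiv.Perm (Fin k)}

theorem mem_matrixSymm_of_commute
    (hA : ∀ i j, A i j = (if j = u i then 1 else 0) + (if j = w i then 1 else 0))
    {α : Equiv.Perm (Fin k)} (h : ∀ i, α (u.symm (w i)) = u.symm (w (α i))) :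
    (α, u * α * u⁻¹) ∈ matrixSymm A := by
  intro i j
  have h1 : (u * α * u⁻¹) j = u (α i) ↔ j = u i := by
    simp [Equiv.Perm.mul_apply, Equiv.Perm.inv_def, Equiv.symm_apply_eq]
  have h2 : (u * α * u⁻¹) j = w (α i) ↔ j = w i := by
    simp [Equiv.Perm.mul_apply, Equiv.Perm.inv_def, ← Equiv.eq_symm_apply u, ← h]
  simp only [hA, h1, h2]

theorem mem_matrixSymm_of_inverts
    (hA : ∀ i j, A i j = (if j = u i then 1 else 0) + (if j = w i then 1 else 0))
    {β : Equiv.Perm (Fin k)} (h : ∀ i, u.symm (w (β (u.symm (w i)))) = β i) :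
    (β, w * β * u⁻¹) ∈ matrixSymm A := by
  intro i j
  have h1 : (w * β * u⁻¹) j = w (β i) ↔ j = u i := by
    simp [Equiv.Perm.mul_apply, Equiv.Perm.inv_def, Equiv.symm_apply_eq]
  have h2 : (w * β * u⁻¹) j = u (β i) ↔ j = w i := by
    rw [← h i]
    simp [Equiv.Perm.mul_apply, Equiv.Perm.inv_def]
  simp only [hA, h1, h2]
  exact add_comm _ _

theorem card_centralizer_le_card_matrixSymm
    (hA : ∀ i j, A i j = (if j = u i then 1 else 0) + (if j = w i then 1 else 0)) :
    Nat.card (Subgroup.centralizer {u⁻¹ * w}) ≤ Nat.card (matrixSymm A) := by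
  refine Nat.card_le_card_of_injective
    (fun α => (⟨(α.1, u * α.1 * u⁻¹), mem_matrixSymm_of_commute hA fun i => ?_⟩ : matrixSymm A)) ?_
  · have := Subgroup.mem_centralizer_singleton_iff.1 α.2
    exact congrArg (fun p => p i) this
  · intro α α' h
    exact Subtype.ext (congrArg (fun x => x.1.1) h)

/-- A permutation is conjugate to its inverse, and the conjugating permutations give as many
symmetries again as the centralizer does. -/
theorem two_mul_card_centralizer_le_card_matrixSymm
    (hA : ∀ i j, A i j = (if j = u i then 1 else 0) + (if j = w i then 1 else 0)) (hne : u ≠ w) :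
    2 * Nat.card (Subgroup.centralizer {u⁻¹ * w}) ≤ Nat.card (matrixSymm A) := by
  have hconj : IsConj (u⁻¹ * w) (u⁻¹ * w)⁻¹ := by
    rw [Equiv.Perm.isConj_iff_cycleType_eq, Equiv.Perm.cycleType_inv]
  obtain ⟨β, hβ⟩ := isConj_iff.1 hconj
  have hβ' : (u⁻¹ * w) * β * (u⁻¹ * w) = β := by
    rw [mul_inv_eq_iff_eq_mul] at hβ
    rw [mul_assoc, hβ, mul_inv_cancel_left]
  have hcomm : ∀ α : Subgroup.centralizer {u⁻¹ * w}, α.1 * (u⁻¹ * w) = u⁻¹ * w * α.1 := fun α =>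
    Subgroup.mem_centralizer_singleton_iff.1 α.2
  have hinv : ∀ α : Subgroup.centralizer {u⁻¹ * w},
      (u⁻¹ * w) * (β * α.1) * (u⁻¹ * w) = β * α.1 := fun α => by
    rw [mul_assoc, mul_assoc β, hcomm, ← mul_assoc, ← mul_assoc, ← mul_assoc, mul_assoc _ u⁻¹ w,
      hβ']
  let F : Subgroup.centralizer {u⁻¹ * w} ⊕ Subgroup.centralizer {u⁻¹ * w} → matrixSymm A :=
    Sum.elim
      (fun α => ⟨(α.1, u * α.1 * u⁻¹), mem_matrixSymm_of_commute hA fun i =>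
        congrArg (fun p => p i) (hcomm α)⟩)
      (fun α => ⟨(β * α.1, w * (β * α.1) * u⁻¹), mem_matrixSymm_of_inverts hA fun i =>
        congrArg (fun p => p i) (hinv α)⟩)
  have hF : Function.Injective F := by
    have hno : ∀ γ δ : Equiv.Perm (Fin k), γ = δ → u * γ * u⁻¹ = w * δ * u⁻¹ → False := by
      rintro γ _ rfl h
      exact hne (mul_right_cancel (mul_right_cancel h))
    rintro (α | α) (α' | α') h
    · exact congrArg _ (Subtype.ext (congrArg (fun x => x.1.1) h))
    · exact (hno _ _ (congrArg (fun x => x.1.1) h) (congrArg (fun x => x.1.2) h)).elim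
    · exact (hno _ _ (congrArg (fun x => x.1.1) h).symm (congrArg (fun x => x.1.2) h).symm).elim
    · exact congrArg _ (Subtype.ext (mul_left_cancel (congrArg (fun x => x.1.1) h)))
  have := Nat.card_le_card_of_injective F hF
  rwa [Nat.card_sum, ← two_mul] at this

end TwoPerms

theorem multiset_sum_le_prod (s : Multiset ℕ) (h : ∀ x ∈ s, 2 ≤ x) :
    s.sum ≤ s.prod ∧ (s ≠ 0 → 2 ≤ s.prod) := by
  induction s using Multiset.induction_on with
  | empty => simp
  | cons a s ih =>
    have ha := h a (Multiset.mem_cons_self a s)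
    obtain ⟨h1, h2⟩ := ih fun x hx => h x (Multiset.mem_cons_of_mem hx)
    rw [Multiset.sum_cons, Multiset.prod_cons]
    by_cases hs : s = 0
    · subst hs; simpa using ha
    · have := h2 hs
      exact ⟨by nlinarith, fun _ => by nlinarith⟩

theorem prod_factorial_pos {k : ℕ} (A : Fin k → Fin k → ℕ) : 0 < ∏ i, ∏ j, (A i j)! :=
  Finset.prod_pos fun _ _ => Finset.prod_pos fun _ _ => Nat.factorial_pos _

/-- The number of symmetries of a `2`-regular bipartite multigraph on `2 * k` vertices, a disjoint
union of cycles, is at least the number `2 * k` of its edges. -/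
theorem two_mul_le_card_of_sum_eq_two {k : ℕ} (hk : k ≠ 0) (A : Fin k → Fin k → ℕ)
    (hr : ∀ i, ∑ j, A i j = 2) (hc : ∀ j, ∑ i, A i j = 2) :
    2 * k ≤ Nat.card (matrixSymm A) * ∏ i, ∏ j, (A i j)! := by
  obtain ⟨u, w, hA⟩ := exists_perm_add_perm A hr hc
  set s := u⁻¹ * w with hs
  have hfix : 2 ^ (k - s.cycleType.sum) ≤ ∏ i, ∏ j, (A i j)! := by
    have h1 : k - s.cycleType.sum = (Finset.univ.filter fun i => s i = i).card := by
      rw [Equiv.Perm.sum_cycleType]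
      have h := Finset.card_filter_add_card_filter_not (s := (Finset.univ : Finset (Fin k)))
        (fun i => s i = i)
      have h' : (Finset.univ.filter fun i => ¬ s i = i) = s.support := by
        ext; simp
      rw [h', Finset.card_univ, Fintype.card_fin] at h
      omega
    rw [h1, ← Finset.prod_const, Finset.prod_filter]
    refine Finset.prod_le_prod' fun i _ => ?_
    split_ifs with h
    · have h2 : w i = u i := by
        have := congrArg u h
        simpa [hs] using this
      have h3 : A i (u i) = 2 := by simp [hA, h2]
      refine Nat.le_of_dvd (Finset.prod_pos fun _ _ => Nat.factorial_pos _) ?_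
      have := Finset.dvd_prod_of_mem (fun j => (A i j)!) (Finset.mem_univ (u i))
      simpa [h3] using this
    · exact Finset.prod_pos fun _ _ => Nat.factorial_pos _
  have hcard := Equiv.Perm.nat_card_centralizer s
  rw [Fintype.card_fin] at hcard
  have hQ : 1 ≤ ∏ n ∈ s.cycleType.toFinset, (s.cycleType.count n)! :=
    Finset.prod_pos fun _ _ => Nat.factorial_pos _
  have hsum : s.cycleType.sum ≤ k := by
    simpa using s.sum_cycleType_le
  obtain ⟨hsp, hp⟩ := multiset_sum_le_prod s.cycleType fun x hx =>
    Equiv.Perm.two_le_of_mem_cycleType hx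
  have hC : (k - s.cycleType.sum)! * s.cycleType.prod ≤ Nat.card (Subgroup.centralizer {s}) := by
    rw [hcard]; exact Nat.le_mul_of_pos_right _ hQ
  by_cases hne : u = w
  · have h1 : s = 1 := by rw [hs, hne, inv_mul_cancel]
    have h2 := (hC.trans (card_centralizer_le_card_matrixSymm hA))
    rw [h1] at h2 hfix
    simp only [Equiv.Perm.cycleType_one, Multiset.sum_zero, Multiset.prod_zero, mul_one,
      Nat.sub_zero] at h2 hfix
    rw [mul_comm]
    refine Nat.mul_le_mul ((Nat.self_le_factorial k).trans h2) (le_trans ?_ hfix)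
    exact le_self_pow (by norm_num) hk
  · have h1 := two_mul_card_centralizer_le_card_matrixSymm hA hne
    have h2 : s.cycleType ≠ 0 := by
      rw [Ne, Equiv.Perm.cycleType_eq_zero]
      intro h
      exact hne (inv_mul_eq_one.1 h)
    have h3 := hp h2
    have h4 : k - s.cycleType.sum < 2 ^ (k - s.cycleType.sum) := Nat.lt_two_pow_self
    have h5 : s.cycleType.prod ≤ Nat.card (Subgroup.centralizer {s}) :=
      (Nat.le_mul_of_pos_left _ (Nat.factorial_pos _)).trans hC
    calc 2 * k ≤ 2 * (s.cycleType.prod * 2 ^ (k - s.cycleType.sum)) := by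
          have : s.cycleType.prod * (k - s.cycleType.sum + 1) ≤
            s.cycleType.prod * 2 ^ (k - s.cycleType.sum) := Nat.mul_le_mul_left _ h4
          nlinarith [Nat.sub_add_cancel hsum]
      _ = 2 * s.cycleType.prod * 2 ^ (k - s.cycleType.sum) := by ring
      _ ≤ _ := Nat.mul_le_mul ((Nat.mul_le_mul_left 2 h5).trans h1) hfix

/-- A nonnegative integer matrix with row and column sums two has a nontrivial symmetry. -/
theorem two_le_card_matrixSymm_of_sum_eq_two {k : ℕ} (hk : 2 ≤ k) (A : Fin k → Fin k → ℕ)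
    (hr : ∀ i, ∑ j, A i j = 2) (hc : ∀ j, ∑ i, A i j = 2) :
    2 ≤ Nat.card (matrixSymm A) := by
  obtain ⟨u, w, hA⟩ := exists_perm_add_perm A hr hc
  by_cases hne : u = w
  · have h2 := card_centralizer_le_card_matrixSymm hA
    rw [Equiv.Perm.nat_card_centralizer, hne, inv_mul_cancel] at h2
    simp only [Equiv.Perm.cycleType_one, Multiset.sum_zero, Multiset.prod_zero, mul_one,
      Nat.sub_zero, Fintype.card_fin, Multiset.toFinset_zero, Finset.prod_empty] at h2
    exact (hk.trans (Nat.self_le_factorial k)).trans h2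
  · have h1 := two_mul_card_centralizer_le_card_matrixSymm hA hne
    have : 0 < Nat.card (Subgroup.centralizer {u⁻¹ * w}) := Nat.card_pos
    omega

/-! ### Rotations of alternating cycles -/

theorem exists_equiv_of_sum_eq_one {ι κ : Type*} [Fintype ι] [Fintype κ] [DecidableEq ι]
    [DecidableEq κ] {P : ι → κ → ℕ} {N : ι → Prop} {D : κ → Prop}
    (hsupp : ∀ i j, P i j ≠ 0 → N i ∧ D j) (hN : ∀ i, N i → ∑ j, P i j = 1)
    (hD : ∀ j, D j → ∑ i, P i j = 1) :
    ∃ e : {i // N i} ≃ {j // D j}, ∀ i : {i // N i}, ∀ j,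
      P i j = if j = (e i : κ) then 1 else 0 := by
  choose u hu using fun i : {i // N i} => exists_eq_ite_of_sum_eq_one (hN i i.2)
  choose v hv using fun j : {j // D j} => exists_eq_ite_of_sum_eq_one (hD j j.2)
  have huD : ∀ i, D (u i) := fun i => (hsupp i (u i) (by simp [hu])).2
  have hvN : ∀ j, N (v j) := fun j => (hsupp (v j) j (by simp [hv])).1
  refine ⟨⟨fun i => ⟨u i, huD i⟩, fun j => ⟨v j, hvN j⟩, fun i => ?_, fun j => ?_⟩, hu⟩
  · have h1 := hu i (u i)
    rw [hv ⟨u i, huD i⟩, if_pos rfl] at h1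
    by_contra hne
    rw [if_neg fun h => hne (Subtype.ext h.symm)] at h1
    exact zero_ne_one h1
  · have h1 := hv j (v j)
    rw [hu ⟨v j, hvN j⟩, if_pos rfl] at h1
    by_contra hne
    rw [if_neg fun h => hne (Subtype.ext h.symm)] at h1
    exact zero_ne_one h1

/-- If every nonzero row and every nonzero column of `C` consists of one `1` and one `-1`, then the
entries form closed walks of alternating sign, and moving every vertex two steps along its walk is
a symmetry of `C` that fixes no nonzero row. -/
theorem exists_rotation {k : ℕ} {C : Fin k → Fin k → ℤ} {N D : Fin k → Prop}
    (hsupp : ∀ i j, C i j ≠ 0 → N i ∧ D j) (hr : ∀ i, ∑ j, C i j = 0) (hc : ∀ j, ∑ i, C i j = 0)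
    (hN : ∀ i, N i → ∑ j, (-C i j).toNat = 1) (hD : ∀ j, D j → ∑ i, (-C i j).toNat = 1) :
    ∃ σ τ : Equiv.Perm (Fin k), (∀ i, ¬ N i → σ i = i) ∧ (∀ i, N i → N (σ i)) ∧
      (∀ j, ¬ D j → τ j = j) ∧ (∀ j, D j → D (τ j)) ∧ (∀ i j, C (σ i) (τ j) = C i j) ∧
      ∀ i, N i → σ i ≠ i := by
  classical
  have hpos : ∀ s : Fin k → ℤ, ∑ j, s j = 0 → ∑ j, (-s j).toNat = 1 → ∑ j, (s j).toNat = 1 := by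
    intro s h1 h2
    have h3 : (∑ j, ((s j).toNat : ℤ)) - ∑ j, ((-s j).toNat : ℤ) = 0 := by
      rw [← Finset.sum_sub_distrib, ← h1]
      exact Finset.sum_congr rfl fun j _ => by omega
    rw [← Nat.cast_sum, ← Nat.cast_sum, h2] at h3
    omega
  obtain ⟨u, hu⟩ := exists_equiv_of_sum_eq_one (P := fun i j => (C i j).toNat) (N := N) (D := D)
    (fun i j h => hsupp i j (by omega)) (fun i hi => hpos _ (hr i) (hN i hi))
    (fun j hj => hpos _ (hc j) (hD j hj))
  obtain ⟨w, hw⟩ := exists_equiv_of_sum_eq_one (P := fun i j => (-C i j).toNat) (N := N) (D := D)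
    (fun i j h => hsupp i j (by omega)) hN hD
  have hC : ∀ i : {i // N i}, ∀ j, C i j =
      (if j = (u i : Fin k) then 1 else 0) - (if j = (w i : Fin k) then 1 else 0) := by
    intro i j
    have h1 := hu i j
    have h2 := hw i j
    have h3 : C i j = ((C i j).toNat : ℤ) - ((-C i j).toNat : ℤ) := by omega
    rw [h3, h1, h2]
    push_cast
    rfl
  set σ : Equiv.Perm (Fin k) := Equiv.Perm.ofSubtype (w.trans u.symm) with hσ
  set τ : Equiv.Perm (Fin k) := Equiv.Perm.ofSubtype (u.symm.trans w) with hτ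
  have hσN : ∀ i : {i // N i}, σ i = (u.symm (w i) : Fin k) := fun i => by
    rw [hσ, Equiv.Perm.ofSubtype_apply_coe]; rfl
  have hτD : ∀ j : {j // D j}, τ j = (w (u.symm j) : Fin k) := fun j => by
    rw [hτ, Equiv.Perm.ofSubtype_apply_coe]; rfl
  have hσn : ∀ i, ¬ N i → σ i = i := fun i hi => Equiv.Perm.ofSubtype_apply_of_not_mem _ hi
  refine ⟨σ, τ, hσn, fun i hi => ?_, fun j hj => Equiv.Perm.ofSubtype_apply_of_not_mem _ hj,
    fun j hj => ?_, fun i j => ?_, fun i hi h => ?_⟩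
  · rw [hσN ⟨i, hi⟩]; exact Subtype.prop _
  · rw [hτD ⟨j, hj⟩]; exact Subtype.prop _
  · by_cases hi : N i
    · have h1 : (u (u.symm (w ⟨i, hi⟩)) : Fin k) = τ (u ⟨i, hi⟩) := by
        rw [hτD]; simp
      have h2 : (w (u.symm (w ⟨i, hi⟩)) : Fin k) = τ (w ⟨i, hi⟩) := by
        rw [hτD]
      rw [hσN ⟨i, hi⟩, hC, hC ⟨i, hi⟩ j, h1, h2]
      simp only [τ.apply_eq_iff_eq]
    · rw [hσn i hi]
      have : ∀ j, C i j = 0 := fun j => by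
        by_contra h; exact hi (hsupp i j h).1
      rw [this, this]
  · rw [hσN ⟨i, hi⟩] at h
    have h1 : u.symm (w ⟨i, hi⟩) = ⟨i, hi⟩ := Subtype.ext h
    rw [Equiv.symm_apply_eq] at h1
    have h2 := hu ⟨i, hi⟩ (u ⟨i, hi⟩)
    have h3 := hw ⟨i, hi⟩ (u ⟨i, hi⟩)
    rw [if_pos rfl] at h2
    rw [h1, if_pos rfl] at h3
    dsimp only at h2 h3
    omega

/-! ### Symmetries of matrices with zero row and column sums -/

theorem card_filter_le_sum {k : ℕ} (f : Fin k → ℕ) (p : Fin k → Prop) [DecidablePred p]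
    (h : ∀ i, p i → 1 ≤ f i) : (Finset.univ.filter p).card ≤ ∑ i, f i := by
  rw [Finset.card_eq_sum_ones, Finset.sum_filter]
  refine Finset.sum_le_sum fun i _ => ?_
  split_ifs with hi
  · exact h i hi
  · exact Nat.zero_le _

/-- If the sum of `f` is at most the number of indices where it is nonzero, then these values are
all `1`. -/
theorem eq_one_of_sum_le_card {k : ℕ} (f : Fin k → ℕ) (p : Fin k → Prop) [DecidablePred p]
    (h : ∀ i, p i → 1 ≤ f i) (hs : ∑ i, f i ≤ (Finset.univ.filter p).card) :
    ∀ i, p i → f i = 1 := by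
  intro i hi
  have h1 : ∑ i, (if p i then 1 else 0) = ∑ i, f i := by
    refine le_antisymm ?_ (by rwa [Finset.card_filter] at hs)
    have := card_filter_le_sum f p h
    rwa [Finset.card_filter] at this
  have h2 := (Finset.sum_eq_sum_iff_of_le fun i _ => by
    split_ifs with hi
    · exact h i hi
    · exact Nat.zero_le _).1 h1 i (Finset.mem_univ i)
  rw [if_pos hi] at h2
  exact h2.symm

theorem exists_neg_of_sum_eq_zero {ι : Type*} [Fintype ι] {s : ι → ℤ} (h : ∑ j, s j = 0)
    (hs : s ≠ 0) : 1 ≤ ∑ j, (-s j).toNat := by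
  by_contra hlt
  have h1 : ∑ j, (-s j).toNat = 0 := by omega
  have h2 : ∀ j, 0 ≤ s j := fun j => by
    have := Finset.sum_eq_zero_iff.1 h1 j (Finset.mem_univ j)
    omega
  have h3 := (Finset.sum_eq_zero_iff_of_nonneg fun j _ => h2 j).1 h
  exact hs (funext fun j => h3 j (Finset.mem_univ j))

/-- Rows that are not zero are charged to the negative entries; zero rows are interchangeable. -/
theorem card_image_rows_le {k : ℕ} (B : Fin k → Fin k → ℤ) (hr : ∀ i, ∑ j, B i j = 0) :
    (Finset.univ.image B).card ≤ (∑ i, ∑ j, (-B i j).toNat) + 1 := by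
  classical
  have h1 : Finset.univ.image B ⊆
      insert 0 ((Finset.univ.filter fun i => B i ≠ 0).image B) := by
    intro s hs
    obtain ⟨i, _, rfl⟩ := Finset.mem_image.1 hs
    by_cases h : B i = 0
    · simp [h]
    · exact Finset.mem_insert_of_mem (Finset.mem_image_of_mem _ (by simp [h]))
  refine (Finset.card_le_card h1).trans ((Finset.card_insert_le _ _).trans ?_)
  exact Nat.succ_le_succ (Finset.card_image_le.trans
    (card_filter_le_sum _ _ fun i hi => exists_neg_of_sum_eq_zero (hr i) hi))

/-- If the negative entries of `B` have total weight `t < k`, then there are at least `k - t` zero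
rows and as many zero columns; when `k - t = 1`, the only obstruction to interchanging two of them
leaves one `1` and one `-1` in every other row and column. -/
theorem two_pow_le_card_of_sum_eq_zero {k : ℕ} (hk : 2 ≤ k) (B : Fin k → Fin k → ℤ)
    (hr : ∀ i, ∑ j, B i j = 0) (hc : ∀ j, ∑ i, B i j = 0) :
    2 ^ (k - ∑ i, ∑ j, (-B i j).toNat) ≤ Nat.card (matrixSymm B) := by
  classical
  set t := ∑ i, ∑ j, (-B i j).toNat with ht
  have ht' : ∑ j, ∑ i, (-B i j).toNat = t := Finset.sum_comm
  have htw := two_pow_twins_le_card B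
  rw [Fintype.card_fin] at htw
  have hrow := card_image_rows_le B hr
  have hcol := card_image_rows_le (fun j i => B i j) hc
  rw [← ht] at hrow
  rw [ht'] at hcol
  by_cases h1 : k - t ≤ (k - (Finset.univ.image B).card) +
      (k - (Finset.univ.image fun j i => B i j).card)
  · exact (Nat.pow_le_pow_right (by norm_num) h1).trans htw
  -- Only the case of a single zero row and a single zero column remains.
  have htk : t + 1 = k := by omega
  have hcr : t + 1 ≤ (Finset.univ.image B).card := by omega
  have hcc : t + 1 ≤ (Finset.univ.image fun j i => B i j).card := by omega
  have key : ∀ M : Fin k → Fin k → ℤ, (∀ i, ∑ j, M i j = 0) → ∑ i, ∑ j, (-M i j).toNat = t →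
      t + 1 ≤ (Finset.univ.image M).card → ∀ i, M i ≠ 0 → ∑ j, (-M i j).toNat = 1 := by
    intro M hM hMt hMc
    refine eq_one_of_sum_le_card _ _ (fun i hi => exists_neg_of_sum_eq_zero (hM i) hi) ?_
    rw [hMt]
    have h2 : Finset.univ.image M ⊆
        insert 0 ((Finset.univ.filter fun i => M i ≠ 0).image M) := by
      intro s hs
      obtain ⟨i, _, rfl⟩ := Finset.mem_image.1 hs
      by_cases h : M i = 0
      · simp [h]
      · exact Finset.mem_insert_of_mem (Finset.mem_image_of_mem _ (by simp [h]))
    have h3 := (Finset.card_le_card h2).trans (Finset.card_insert_le _ _)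
    have h4 := Finset.card_image_le (s := Finset.univ.filter fun i => M i ≠ 0) (f := M)
    omega
  obtain ⟨σ, τ, -, -, -, -, hst, hne⟩ := exists_rotation (C := B) (N := fun i => B i ≠ 0)
    (D := fun j => (fun i => B i j) ≠ 0)
    (fun i j h => ⟨fun h' => h (congrFun h' j), fun h' => h (congrFun h' i)⟩) hr hc
    (key B hr ht.symm hcr) (key (fun j i => B i j) hc ht' hcc)
  have hex : ∃ i, B i ≠ 0 := by
    by_contra hno
    push Not at hno
    have : (Finset.univ.image B).card ≤ 1 := by
      rw [Finset.card_le_one]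
      intro a ha b hb
      obtain ⟨i, _, rfl⟩ := Finset.mem_image.1 ha
      obtain ⟨i', _, rfl⟩ := Finset.mem_image.1 hb
      rw [hno, hno]
    omega
  obtain ⟨i, hi⟩ := hex
  have : k - t = 1 := by omega
  rw [this, pow_one]
  refine two_le_card_of_ne_one (H := matrixSymm B) (g := (σ, τ)) hst fun h => hne i hi ?_
  have h' : σ = 1 := congrArg Prod.fst h
  rw [h']; rfl

/-! ### Symmetries of matrices with row and column sums one -/

theorem exists_leaf_map {k : ℕ} (hk : k ≠ 0) (B : Fin k → Fin k → ℤ) (hr : ∀ i, ∑ j, B i j = 1) :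
    ∃ l : Fin k → Fin k, ∀ i, (¬ ∃ j, B i j < 0) → ∀ j, B i j = if j = l i then 1 else 0 := by
  have : ∀ i, ∃ l : Fin k, (¬ ∃ j, B i j < 0) → ∀ j, B i j = if j = l then 1 else 0 := by
    intro i
    by_cases h : ∃ j, B i j < 0
    · exact ⟨⟨0, Nat.pos_of_ne_zero hk⟩, fun h' => absurd h h'⟩
    · push Not at h
      have h1 : ∑ j, (B i j).toNat = 1 := by
        have h2 : ∑ j, ((B i j).toNat : ℤ) = 1 := by
          rw [← hr i]
          exact Finset.sum_congr rfl fun j _ => Int.toNat_of_nonneg (h j)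
        exact_mod_cast h2
      obtain ⟨l, hl⟩ := exists_eq_ite_of_sum_eq_one h1
      refine ⟨l, fun _ j => ?_⟩
      have h2 := hl j
      have h3 := h j
      split_ifs at h2 ⊢ <;> omega
  choose l hl using this
  exact ⟨l, hl⟩

theorem one_le_sum_of_neg {ι : Type*} [Fintype ι] {s : ι → ℤ} (h : ∃ j, s j < 0) :
    1 ≤ ∑ j, (-s j).toNat := by
  obtain ⟨j, hj⟩ := h
  have := Finset.single_le_sum (f := fun j => (-s j).toNat) (fun _ _ => Nat.zero_le _)
    (Finset.mem_univ j)
  omega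

/-- The extremal configuration for row and column sums `1`: besides the identity matrix, every
row in `N` and every column in the disjoint set `L` carries one `1` and one `-1`. -/
theorem exists_ne_one_of_one_add {k : ℕ} {B : Fin k → Fin k → ℤ} {N L : Fin k → Prop}
    (hNL : ∀ i, N i → ¬ L i) (hB : ∀ i, B i i = 1) (hr : ∀ i, ∑ j, B i j = 1)
    (hc : ∀ j, ∑ i, B i j = 1) (hsupp : ∀ i j, i ≠ j → B i j ≠ 0 → N i ∧ L j)
    (hN : ∀ i, N i → ∑ j, (-B i j).toNat = 1) (hL : ∀ j, L j → ∑ i, (-B i j).toNat = 1)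
    (hex : ∃ i, N i) : ∃ g ∈ matrixSymm B, g ≠ 1 := by
  let C : Fin k → Fin k → ℤ := fun i j => B i j - if i = j then 1 else 0
  have hBC : ∀ i j, B i j = C i j + if i = j then 1 else 0 := fun i j => by simp [C]
  have hneg : ∀ i j, (-C i j).toNat = (-B i j).toNat := fun i j => by
    by_cases h : i = j
    · subst h; simp [C, hB]
    · simp [C, h]
  have hCs : ∀ i j, C i j ≠ 0 → N i ∧ L j := fun i j h => by
    by_cases hij : i = j
    · subst hij; simp [C, hB] at h
    · exact hsupp i j hij (by simpa [C, hij] using h)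
  obtain ⟨σ, τ, hσ, hσN, hτ, hτL, hst, hne⟩ := exists_rotation (C := C) (N := N) (D := L) hCs
    (fun i => by simp [C, hr]) (fun j => by simp [C, hc])
    (fun i hi => by rw [← hN i hi]; exact Finset.sum_congr rfl fun j _ => hneg i j)
    (fun j hj => by rw [← hL j hj]; exact Finset.sum_congr rfl fun i _ => hneg i j)
  have hρN : ∀ i, N i → σ (τ i) = σ i := fun i hi => by rw [hτ i (hNL i hi)]
  have hρL : ∀ j, L j → σ (τ j) = τ j := fun j hj => hσ _ fun h => hNL _ h (hτL j hj)
  have hρNn : ∀ i, ¬ N i → ¬ N (σ (τ i)) := fun i hi h => by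
    by_cases hiL : L i
    · rw [hρL i hiL] at h; exact hNL _ h (hτL i hiL)
    · rw [hτ i hiL, hσ i hi] at h; exact hi h
  have hρLn : ∀ i, ¬ L i → ¬ L (σ (τ i)) := fun i hi h => by
    rw [hτ i hi] at h
    by_cases hiN : N i
    · exact hNL _ (hσN i hiN) h
    · rw [hσ i hiN] at h; exact hi h
  have hzero : ∀ i j, (¬ N i ∨ ¬ L j) → C i j = 0 := fun i j h => by
    by_contra h0
    rcases h with h | h
    · exact h (hCs i j h0).1
    · exact h (hCs i j h0).2
  refine ⟨(σ * τ, σ * τ), fun i j => ?_, fun h => ?_⟩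
  · change B (σ (τ i)) (σ (τ j)) = B i j
    rw [hBC, hBC i j]
    simp only [σ.apply_eq_iff_eq, τ.apply_eq_iff_eq]
    congr 1
    by_cases hi : N i
    · by_cases hj : L j
      · rw [hρN i hi, hρL j hj, hst]
      · rw [hzero _ _ (Or.inr (hρLn j hj)), hzero _ _ (Or.inr hj)]
    · rw [hzero _ _ (Or.inl (hρNn i hi)), hzero _ _ (Or.inl hi)]
  · obtain ⟨i, hi⟩ := hex
    have h1 : σ * τ = 1 := congrArg Prod.fst h
    have h2 : σ (τ i) = i := congrArg (fun p => p i) h1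
    rw [hρN i hi] at h2
    exact hne i hi h2

/-- Column permutations move along with an injective relabelling of the columns. -/
theorem exists_ne_one_of_relabel {k : ℕ} {B : Fin k → Fin k → ℤ} (p : Equiv.Perm (Fin k))
    (h : ∃ g ∈ matrixSymm (fun i j => B i (p j)), g ≠ 1) : ∃ g ∈ matrixSymm B, g ≠ 1 := by
  obtain ⟨⟨σ, τ⟩, hg, hne⟩ := h
  refine ⟨(σ, p * τ * p⁻¹), fun i j => ?_, fun h' => hne ?_⟩
  · have := hg i (p⁻¹ j)
    simpa using this
  · have h1 : σ = 1 := congrArg Prod.fst h'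
    have h2 : p * τ * p⁻¹ = 1 := congrArg Prod.snd h'
    rw [mul_inv_eq_one, mul_eq_left] at h2
    rw [h1, h2]; rfl

/-- Let `B` have row and column sums `1` and negative entries of total weight `t < k / 2`. At most
`t` rows and at most `t` columns meet a negative entry; every other row and column consists of a
single `1`. Two such rows with their `1` in the same column, and likewise two such columns, can be
interchanged, and so can the `1`s that are alone in both their row and their column. -/
theorem two_pow_le_card_of_sum_eq_one {k : ℕ} (hk : 3 ≤ k) (B : Fin k → Fin k → ℤ)
    (hr : ∀ i, ∑ j, B i j = 1) (hc : ∀ j, ∑ i, B i j = 1) :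
    2 ^ ((k + 1) / 2 - ∑ i, ∑ j, (-B i j).toNat) ≤ Nat.card (matrixSymm B) := by
  classical
  set t := ∑ i, ∑ j, (-B i j).toNat with ht
  have ht' : ∑ j, ∑ i, (-B i j).toNat = t := Finset.sum_comm
  obtain ⟨l, hl⟩ := exists_leaf_map (by omega) B hr
  obtain ⟨m, hm⟩ := exists_leaf_map (by omega) (fun j i => B i j) hc
  set N : Fin k → Prop := fun i => ∃ j, B i j < 0 with hN
  set D : Fin k → Prop := fun j => ∃ i, B i j < 0 with hD
  change ∀ j, ¬ D j → ∀ i, B i j = if i = m j then 1 else 0 at hm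
  change ∀ i, ¬ N i → ∀ j, B i j = if j = l i then 1 else 0 at hl
  set FN := Finset.univ.filter N
  set FD := Finset.univ.filter D
  set R := Finset.univ.filter fun i => ¬ N i ∧ D (l i) with hR
  set C := Finset.univ.filter fun j => ¬ D j ∧ N (m j) with hC
  set I := Finset.univ.filter fun i => ¬ N i ∧ ¬ D (l i) with hI
  set J := Finset.univ.filter fun j => ¬ D j ∧ ¬ N (m j) with hJ
  have hFN : FN.card ≤ t := card_filter_le_sum _ _ fun i hi => one_le_sum_of_neg hi
  have hFD : FD.card ≤ t := by
    rw [← ht']; exact card_filter_le_sum _ _ fun i hi => one_le_sum_of_neg hi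
  have split : ∀ P Q : Fin k → Prop, (Finset.univ.filter P).card +
      (Finset.univ.filter fun i => ¬ P i ∧ Q i).card +
      (Finset.univ.filter fun i => ¬ P i ∧ ¬ Q i).card = k := by
    intro P Q
    have h1 := Finset.card_filter_add_card_filter_not (s := (Finset.univ : Finset (Fin k))) P
    have h2 := Finset.card_filter_add_card_filter_not
      (s := (Finset.univ : Finset (Fin k)).filter fun i => ¬ P i) Q
    rw [Finset.filter_filter, Finset.filter_filter] at h2
    rw [Finset.card_univ, Fintype.card_fin] at h1
    omega
  have hkr : FN.card + R.card + I.card = k := by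
    convert split N fun i => D (l i)
  have hkc : FD.card + C.card + J.card = k := by
    convert split D fun j => N (m j)
  have hml : ∀ i, ¬ N i → ¬ D (l i) → m (l i) = i := fun i h1 h2 => by
    have h3 := hl i h1 (l i)
    rw [hm (l i) h2, if_pos rfl] at h3
    by_contra hne
    rw [if_neg fun h => hne h.symm] at h3
    exact zero_ne_one h3
  have hlm : ∀ j, ¬ D j → ¬ N (m j) → l (m j) = j := fun j h1 h2 => by
    have h3 := hm j h1 (m j)
    rw [hl (m j) h2, if_pos rfl] at h3
    by_contra hne
    rw [if_neg fun h => hne h.symm] at h3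
    exact zero_ne_one h3
  have hIl : ∀ i, ¬ N i ∧ ¬ D (l i) → ¬ D (l i) ∧ ¬ N (m (l i)) := fun i hi =>
    ⟨hi.2, by rw [hml i hi.1 hi.2]; exact hi.1⟩
  have hJm : ∀ j, ¬ D j ∧ ¬ N (m j) → ¬ N (m j) ∧ ¬ D (l (m j)) := fun j hj =>
    ⟨hj.2, by rw [hlm j hj.1 hj.2]; exact hj.1⟩
  let e : {i // ¬ N i ∧ ¬ D (l i)} ≃ {j // ¬ D j ∧ ¬ N (m j)} :=
    ⟨fun i => ⟨l i, hIl i i.2⟩, fun j => ⟨m j, hJm j j.2⟩,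
      fun i => Subtype.ext (hml i i.2.1 i.2.2), fun j => Subtype.ext (hlm j j.2.1 j.2.2)⟩
  have hIJ : I.card = J.card := by
    have := Fintype.card_congr e
    rwa [Fintype.card_subtype, Fintype.card_subtype] at this
  have hxR : (R.image l).card ≤ R.card := Finset.card_image_le
  have hyC : (C.image m).card ≤ C.card := Finset.card_image_le
  have hxD : (R.image l).card ≤ FD.card := Finset.card_le_card fun j hj => by
    obtain ⟨i, hi, rfl⟩ := Finset.mem_image.1 hj
    exact Finset.mem_filter.2 ⟨Finset.mem_univ _, (Finset.mem_filter.1 hi).2.2⟩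
  have hyN : (C.image m).card ≤ FN.card := Finset.card_le_card fun j hj => by
    obtain ⟨i, hi, rfl⟩ := Finset.mem_image.1 hj
    exact Finset.mem_filter.2 ⟨Finset.mem_univ _, (Finset.mem_filter.1 hi).2.2⟩
  -- All isolated rows receive the same label; the other rows are labelled by their entries.
  let f : Fin k → Option (Fin k → ℤ) := fun i => if ¬ N i ∧ ¬ D (l i) then none else some (B i)
  let s : Fin k → Fin k → ℤ := fun j j' => if j' = j then 1 else 0
  have hfcard : (Finset.univ.image f).card ≤ FN.card + (R.image l).card +
      (I.image fun _ => ()).card := by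
    have h1 : Finset.univ.image f ⊆ FN.image (fun i => some (B i)) ∪
        (R.image l).image (fun j => some (s j)) ∪
        (I.image fun _ => ()).image (fun _ => none) := by
      intro x hx
      obtain ⟨i, _, rfl⟩ := Finset.mem_image.1 hx
      by_cases h1 : N i
      · refine Finset.mem_union_left _ (Finset.mem_union_left _ (Finset.mem_image.2 ⟨i, ?_, ?_⟩))
        · simpa [FN] using h1
        · simp [f, h1]
      · by_cases h2 : D (l i)
        · refine Finset.mem_union_left _ (Finset.mem_union_right _
            (Finset.mem_image.2 ⟨l i, Finset.mem_image_of_mem _ ?_, ?_⟩))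
          · simp [R, h1, h2]
          · simp only [f, h1, h2, not_true_eq_false, and_false, if_false, Option.some.injEq]
            exact funext fun j => (hl i h1 j).symm
        · refine Finset.mem_union_right _ (Finset.mem_image.2 ⟨(), ?_, ?_⟩)
          · exact Finset.mem_image.2 ⟨i, by simp [I, h1, h2], rfl⟩
          · simp [f, h1, h2]
    refine (Finset.card_le_card h1).trans ((Finset.card_union_le _ _).trans ?_)
    refine Nat.add_le_add ((Finset.card_union_le _ _).trans ?_) Finset.card_image_le
    exact Nat.add_le_add Finset.card_image_le Finset.card_image_le
  have hgcard : (Finset.univ.image fun j i => B i j).card ≤ FD.card + (C.image m).card +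
      J.card := by
    have h1 : (Finset.univ.image fun j i => B i j) ⊆ FD.image (fun j i => B i j) ∪
        (C.image m).image s ∪ J.image (fun j i => B i j) := by
      intro x hx
      obtain ⟨j, _, rfl⟩ := Finset.mem_image.1 hx
      by_cases h1 : D j
      · refine Finset.mem_union_left _ (Finset.mem_union_left _ (Finset.mem_image.2 ⟨j, ?_, rfl⟩))
        simpa [FD] using h1
      · by_cases h2 : N (m j)
        · refine Finset.mem_union_left _ (Finset.mem_union_right _
            (Finset.mem_image.2 ⟨m j, Finset.mem_image_of_mem _ ?_, ?_⟩))
          · simp [C, h1, h2]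
          · exact funext fun i => (hm j h1 i).symm
        · refine Finset.mem_union_right _ (Finset.mem_image.2 ⟨j, ?_, rfl⟩)
          simp [J, h1, h2]
    refine (Finset.card_le_card h1).trans ((Finset.card_union_le _ _).trans ?_)
    refine Nat.add_le_add ((Finset.card_union_le _ _).trans ?_) Finset.card_image_le
    exact Nat.add_le_add Finset.card_image_le Finset.card_image_le
  have hunit : (I.image fun _ => ()).card ≤ 1 ∧ (I.image fun _ => ()).card ≤ I.card :=
    ⟨by simpa using Finset.card_le_univ (I.image fun _ => ()), Finset.card_image_le⟩
  have hlift : ∀ σ : Equiv.Perm (Fin k), f ∘ σ = f → ∃ τ, (σ, τ) ∈ matrixSymm B := by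
    intro σ hσ
    have hfi : ∀ i, f i = none ↔ ¬ N i ∧ ¬ D (l i) := fun i => by
      simp only [f]; split_ifs with h <;> simp [h]
    have hσI : ∀ i, (¬ N (σ i) ∧ ¬ D (l (σ i))) ↔ ¬ N i ∧ ¬ D (l i) := fun i => by
      rw [← hfi, ← hfi]
      exact Eq.congr_left (congrFun hσ i)
    refine ⟨(σ.subtypePerm hσI).extendDomain e, fun i j => ?_⟩
    set τ := (σ.subtypePerm hσI).extendDomain e with hτ
    change B (σ i) (τ j) = B i j
    by_cases hi : ¬ N i ∧ ¬ D (l i)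
    · have h1 : τ (l i) = l (σ i) :=
        Equiv.Perm.extendDomain_apply_image (σ.subtypePerm hσI) e ⟨i, hi⟩
      rw [hl i hi.1, hl (σ i) ((hσI i).2 hi).1, ← h1]
      simp only [τ.apply_eq_iff_eq]
    · have h1 : B (σ i) = B i := by
        have := congrFun hσ i
        simpa [f, hi, hσI i] using this
      rw [h1]
      by_cases hj : ¬ D j ∧ ¬ N (m j)
      · have h2 : ∀ j, ¬ D j ∧ ¬ N (m j) → B i j = 0 := fun j hj => by
          rw [hm j hj.1 i, if_neg]
          rintro rfl
          exact hi (hJm j hj)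
        have h3 : ¬ D (τ j) ∧ ¬ N (m (τ j)) := by
          have := Equiv.Perm.extendDomain_apply_subtype (σ.subtypePerm hσI) e hj
          rw [← hτ] at this
          rw [this]
          exact (e (σ.subtypePerm hσI (e.symm ⟨j, hj⟩))).2
        rw [h2 _ h3, h2 _ hj]
      · exact congrArg (B i)
          (Equiv.Perm.extendDomain_apply_not_subtype (σ.subtypePerm hσI) e hj)
  have hmul := (Nat.mul_le_mul (two_pow_le_card_preserving f)
    (two_pow_le_card_preserving fun j i => B i j)).trans (card_preserving_mul_le B f hlift)
  rw [← pow_add, Fintype.card_fin] at hmul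
  by_cases h1 : (k + 1) / 2 - t ≤ k - (Finset.univ.image f).card +
      (k - (Finset.univ.image fun j i => B i j).card)
  · exact (Nat.pow_le_pow_right (by norm_num) h1).trans hmul
  -- What remains is `k = 2 * t + 1`, a single isolated entry, exactly one `-1` in each of `t` rows
  -- and `t` columns, and exactly one leaf at each of these rows and columns.
  clear hmul
  have hex : I.card = 1 ∧ FN.card = t ∧ FD.card = t ∧ (R.image l).card = t ∧ R.card = t ∧
      (C.image m).card = t ∧ C.card = t ∧ (k + 1) / 2 - t = 1 ∧ 1 ≤ t := by omega
  obtain ⟨-, hN1, hD1, hx1, hR1, hy1, hC1, hexp, ht1⟩ := hex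
  rw [hexp, pow_one]
  have hNone : ∀ i, N i → ∑ j, (-B i j).toNat = 1 :=
    eq_one_of_sum_le_card _ _ (fun i hi => one_le_sum_of_neg hi) (by rw [← ht]; exact hN1.ge)
  have hDone : ∀ j, D j → ∑ i, (-B i j).toNat = 1 :=
    eq_one_of_sum_le_card _ _ (fun i hi => one_le_sum_of_neg hi) (by rw [ht']; exact hD1.ge)
  have hlinj : Set.InjOn l R := Finset.card_image_iff.1 (hx1.trans hR1.symm)
  have hminj : Set.InjOn m C := Finset.card_image_iff.1 (hy1.trans hC1.symm)
  have hmsurj : ∀ i, N i → ∃ j, (¬ D j ∧ N (m j)) ∧ m j = i := by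
    have h2 : C.image m = FN := by
      refine Finset.eq_of_subset_of_card_le (fun j hj => ?_) (by omega)
      obtain ⟨i, hi, rfl⟩ := Finset.mem_image.1 hj
      exact Finset.mem_filter.2 ⟨Finset.mem_univ _, (Finset.mem_filter.1 hi).2.2⟩
    intro i hi
    have h3 : i ∈ C.image m := by rw [h2]; simpa [FN] using hi
    obtain ⟨j, hj, rfl⟩ := Finset.mem_image.1 h3
    exact ⟨j, (Finset.mem_filter.1 hj).2, rfl⟩
  have hp : ∀ i, ∃ j, B i j = 1 ∧ (N i → ¬ D j ∧ m j = i) ∧ (¬ N i → j = l i) := by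
    intro i
    by_cases hi : N i
    · obtain ⟨j, ⟨hj, -⟩, rfl⟩ := hmsurj i hi
      exact ⟨j, by simp [hm j hj], fun _ => ⟨hj, rfl⟩, fun h => absurd hi h⟩
    · exact ⟨l i, by simp [hl i hi], fun h => absurd h hi, fun _ => rfl⟩
  choose p hp1 hpN hpn using hp
  have hpinj : Function.Injective p := by
    intro i i' h
    by_cases hd : D (p i)
    · have hi : ¬ N i := fun hi => (hpN i hi).1 hd
      have hi' : ¬ N i' := fun hi => (hpN i' hi).1 (h ▸ hd)
      refine hlinj (Finset.mem_coe.2 (Finset.mem_filter.2 ⟨Finset.mem_univ _, hi, ?_⟩))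
        (Finset.mem_coe.2 (Finset.mem_filter.2 ⟨Finset.mem_univ _, hi', ?_⟩)) ?_
      · rw [← hpn i hi]; exact hd
      · rw [← hpn i' hi', ← h]; exact hd
      · rw [← hpn i hi, ← hpn i' hi', h]
    · have h2 := hp1 i
      have h3 := hp1 i'
      rw [← h] at h3
      rw [hm _ hd] at h2 h3
      by_contra hne
      split_ifs at h2 with h4
      · rw [if_neg fun h5 => hne (h4.trans h5.symm)] at h3
        exact zero_ne_one h3
      · exact zero_ne_one h2
  let π : Equiv.Perm (Fin k) := Equiv.ofBijective p (Finite.injective_iff_bijective.1 hpinj)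
  obtain ⟨g, hg, hg1⟩ : ∃ g ∈ matrixSymm B, g ≠ 1 := by
    refine exists_ne_one_of_relabel π (exists_ne_one_of_one_add (N := N) (L := fun j => D (p j))
      (fun i hi => (hpN i hi).1) hp1 (fun i => ?_) (fun j => hc _) (fun i j hij h => ?_)
      (fun i hi => ?_) (fun j hj => hDone _ hj) ?_)
    · rw [← hr i]; exact Equiv.sum_comp π fun j => B i j
    · change B i (p j) ≠ 0 at h
      constructor
      · by_contra hi
        rw [hl i hi, if_neg] at h
        · exact h rfl
        · rw [← hpn i hi]; exact fun h' => hij (hpinj h').symm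
      · by_contra hj
        have h2 := hp1 j
        rw [hm _ hj] at h h2
        split_ifs at h h2 with h3 h4
        · exact hij (h3.trans h4.symm)
        · exact zero_ne_one h2
        · exact h rfl
        · exact h rfl
    · rw [← hNone i hi]; exact Equiv.sum_comp π fun j => (-B i j).toNat
    · have : FN.Nonempty := Finset.card_pos.1 (by omega)
      obtain ⟨i, hi⟩ := this
      exact ⟨i, (Finset.mem_filter.1 hi).2⟩
  exact two_le_card_of_ne_one hg hg1

/-! ### Patterns of signs and their symmetries -/

/-- A symmetry of a `k × k` sign pattern: `s` permutes the row indices below `k` and `u` the column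
indices below `k`, and both the positions of `1` (`Pos`) and of `-1` (`Neg`) are respected. Indices
are natural numbers, and nothing is required of `s` and `u` outside the range. -/
structure IsPatternSymm (k : ℕ) (Pos Neg : ℕ → ℕ → Prop) (s u : ℕ → ℕ) : Prop where
  s_lt : ∀ i, i < k → s i < k
  u_lt : ∀ j, j < k → u j < k
  s_inj : ∀ i i', i < k → i' < k → s i = s i' → i = i'
  u_inj : ∀ j j', j < k → j' < k → u j = u j' → j = j'
  s_surj : ∀ i, i < k → ∃ i', i' < k ∧ s i' = i
  u_surj : ∀ j, j < k → ∃ j', j' < k ∧ u j' = j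
  pos : ∀ i j, i < k → j < k → (Pos (s i) (u j) ↔ Pos i j)
  neg : ∀ i j, i < k → j < k → (Neg (s i) (u j) ↔ Neg i j)

/-- A permutation of an initial segment that fixes everything but possibly the last element. -/
theorem eq_of_forall_lt {K : ℕ} {s : ℕ → ℕ} (hlt : s K < K + 1)
    (hinj : ∀ i i', i < K + 1 → i' < K + 1 → s i = s i' → i = i') (h : ∀ i, i < K → s i = i) :
    s K = K := by
  by_contra hne
  have h1 := h (s K) (by omega)
  have h2 := hinj (s K) K (by omega) (by omega) h1
  omega

/-- The positions of `1` for row and column sums `0`: an alternating closed walk through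
`k - 1` rows and columns, modified in the rows `0` and `3` and the columns `2` and `3`. -/
def posZero (k i j : ℕ) : Prop :=
  (j = i ∧ i + 1 < k ∧ i ≠ 3) ∨ (i = 0 ∧ j = 3) ∨ (i = 3 ∧ j = 2)

/-- The positions of `-1` for row and column sums `0`. -/
def negZero (k i j : ℕ) : Prop :=
  (j = i + 1 ∧ j + 1 < k) ∨ (i + 2 = k ∧ j = 0) ∨ (i = 0 ∧ j = 2)

theorem eq_of_isPatternSymm_zero {k : ℕ} (hk : 8 ≤ k) {s u : ℕ → ℕ}
    (h : IsPatternSymm k (posZero k) (negZero k) s u) : ∀ i, i < k → s i = i ∧ u i = i := by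
  obtain ⟨hs, hu, hsi, hui, -, -, hp, hn⟩ := h
  have P : ∀ i j, i < k → j < k → posZero k i j → posZero k (s i) (u j) :=
    fun i j hi hj => (hp i j hi hj).2
  have M : ∀ i j, i < k → j < k → negZero k i j → negZero k (s i) (u j) :=
    fun i j hi hj => (hn i j hi hj).2
  simp only [posZero, negZero] at P M
  -- Row `0` and column `2` are the only ones with two entries `1`.
  have s0 : s 0 = 0 := by
    have h1 := P 0 0 (by omega) (by omega) (by omega)
    have h2 := P 0 3 (by omega) (by omega) (by omega)
    have h3 := hui 0 3 (by omega) (by omega)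
    omega
  have u2 : u 2 = 2 := by
    have h1 := P 2 2 (by omega) (by omega) (by omega)
    have h2 := P 3 2 (by omega) (by omega) (by omega)
    have h3 := hsi 2 3 (by omega) (by omega)
    omega
  have u1 : u 1 = 1 := by
    have h1 := M 0 1 (by omega) (by omega) (by omega)
    have h3 := hui 1 2 (by omega) (by omega)
    omega
  have s1 : s 1 = 1 := by
    have h1 := P 1 1 (by omega) (by omega) (by omega)
    omega
  have s2 : s 2 = 2 ∧ u 3 = 3 := by
    have h1 := P 2 2 (by omega) (by omega) (by omega)
    have h2 := M 2 3 (by omega) (by omega) (by omega)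
    have h3 := P 0 3 (by omega) (by omega) (by omega)
    omega
  have s3 : s 3 = 3 := by
    have h1 := P 3 2 (by omega) (by omega) (by omega)
    have h3 := hsi 2 3 (by omega) (by omega)
    omega
  have u4 : u 4 = 4 := by
    have h1 := M 3 4 (by omega) (by omega) (by omega)
    omega
  have chain : ∀ n, n + 5 < k → s (n + 4) = n + 4 ∧ u (n + 4) = n + 4 := by
    intro n
    induction n with
    | zero =>
      intro hn
      have h1 := P 4 4 (by omega) (by omega) (by omega)
      change s 4 = 4 ∧ u 4 = 4
      exact ⟨by omega, u4⟩
    | succ n ih =>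
      intro hn
      obtain ⟨h1, h2⟩ := ih (by omega)
      have h3 := M (n + 4) (n + 5) (by omega) (by omega) (by omega)
      have h4 : u (n + 5) = n + 5 := by omega
      have h5 := P (n + 5) (n + 5) (by omega) (by omega) (by omega)
      change s (n + 5) = n + 5 ∧ u (n + 5) = n + 5
      exact ⟨by omega, h4⟩
  have u0 : u 0 = 0 := by
    have h1 := M (k - 2) 0 (by omega) (by omega) (by omega)
    have h2 := (chain (k - 6) (by omega)).1
    rw [show k - 6 + 4 = k - 2 by omega] at h2
    omega
  have all : ∀ i, i < k - 1 → s i = i ∧ u i = i := by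
    intro i hi
    by_cases h4 : 4 ≤ i
    · have := chain (i - 4) (by omega)
      rwa [Nat.sub_add_cancel h4] at this
    · have : i = 0 ∨ i = 1 ∨ i = 2 ∨ i = 3 := by omega
      rcases this with rfl | rfl | rfl | rfl
      · exact ⟨s0, u0⟩
      · exact ⟨s1, u1⟩
      · exact ⟨s2.1, u2⟩
      · exact ⟨s3, s2.2⟩
  obtain ⟨K, rfl⟩ : ∃ K, k = K + 1 := ⟨k - 1, by omega⟩
  intro i hi
  by_cases h1 : i = K
  · subst h1
    exact ⟨eq_of_forall_lt (hs _ hi) hsi fun i hi => (all i hi).1,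
      eq_of_forall_lt (hu _ hi) hui fun i hi => (all i hi).2⟩
  · exact all i (by omega)

/-- The positions of `1` for row and column sums `1`. The rows and columns below `t` form the core:
each of them has one further `1` in a row or column outside the core, apart from row `0` and column
`0`, which share it. -/
def posOne (t i j : ℕ) : Prop :=
  (i = 0 ∧ j = 0) ∨ (1 ≤ i ∧ i < t ∧ j + 1 = t + i) ∨ (1 ≤ j ∧ j < t ∧ i + 1 = t + j) ∨
    (i + 1 = 2 * t ∧ j + 1 = 2 * t) ∨ (j = i + 1 ∧ j < t) ∨ (i + 1 = t ∧ j = 0)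

/-- The positions of `-1` for row and column sums `1`. -/
def negOne (t i j : ℕ) : Prop :=
  (j = i + 2 ∧ j < t) ∨ (i + 2 = t ∧ j = 0) ∨ (i + 1 = t ∧ j = 1)

theorem eq_of_isPatternSymm_one {k t : ℕ} (ht : 4 ≤ t) (hkt : k + 1 = 2 * t ∨ k = 2 * t)
    {s u : ℕ → ℕ} (h : IsPatternSymm k (posOne t) (negOne t) s u) :
    ∀ i, i < k → s i = i ∧ u i = i := by
  obtain ⟨hs, hu, hsi, hui, -, -, hp, hn⟩ := h
  have P : ∀ i j, i < k → j < k → posOne t i j → posOne t (s i) (u j) :=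
    fun i j hi hj => (hp i j hi hj).2
  have M : ∀ i j, i < k → j < k → negOne t i j → negOne t (s i) (u j) :=
    fun i j hi hj => (hn i j hi hj).2
  simp only [posOne, negOne] at P M
  -- Row `0` is the only row with a `-1` whose entries `1` all lie in columns with a `-1`.
  have s0 : s 0 = 0 := by
    have h1 := M 0 2 (by omega) (by omega) (by omega)
    have h2 := P 0 0 (by omega) (by omega) (by omega)
    have h3 := P 0 1 (by omega) (by omega) (by omega)
    have h4 := M (t - 2) 0 (by omega) (by omega) (by omega)
    have h5 := M (t - 1) 1 (by omega) (by omega) (by omega)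
    have h6 := hui 0 1 (by omega) (by omega)
    have h7 : s 0 < t := by omega
    have h8 : u 0 < t := by omega
    have h9 : u 1 < t := by omega
    clear h1 h4 h5
    omega
  have chain : ∀ n, n + 1 < t → s n = n ∧ (2 ≤ n + 1 → u (n + 1) = n + 1) := by
    intro n
    induction n with
    | zero => exact fun _ => ⟨s0, fun h => by omega⟩
    | succ n ih =>
      intro hn
      obtain ⟨h1, -⟩ := ih (by omega)
      have h2 := M n (n + 2) (by omega) (by omega) (by omega)
      have h3 : u (n + 2) = n + 2 := by omega
      have h4 := P (n + 1) (n + 2) (by omega) (by omega) (by omega)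
      have h5 : s (n + 1) < t := by
        by_cases h6 : n + 3 < t
        · have := M (n + 1) (n + 3) (by omega) (by omega) (by omega)
          omega
        · have := M (n + 1) 0 (by omega) (by omega) (by omega)
          omega
      exact ⟨by omega, fun _ => h3⟩
  have u0 : u 0 = 0 := by
    have h1 := (chain (t - 2) (by omega)).1
    have h2 := M (t - 2) 0 (by omega) (by omega) (by omega)
    omega
  have sl : s (t - 1) = t - 1 := by
    have h1 := P (t - 1) 0 (by omega) (by omega) (by omega)
    have h2 := hsi 0 (t - 1) (by omega) (by omega)
    omega
  have u1 : u 1 = 1 := by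
    have h2 := M (t - 1) 1 (by omega) (by omega) (by omega)
    omega
  have core : ∀ i, i < t → s i = i ∧ u i = i := by
    intro i hi
    constructor
    · by_cases h1 : i + 1 < t
      · exact (chain i h1).1
      · obtain rfl : i = t - 1 := by omega
        exact sl
    · by_cases h1 : 2 ≤ i
      · have := (chain (i - 1) (by omega)).2 (by omega)
        rwa [Nat.sub_add_cancel (by omega)] at this
      · have : i = 0 ∨ i = 1 := by omega
        rcases this with rfl | rfl
        · exact u0
        · exact u1
  have leaf : ∀ i, i < 2 * t - 1 → s i = i ∧ u i = i := by
    intro n hn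
    by_cases h : n < t
    · exact core n h
    obtain ⟨i, rfl⟩ : ∃ i, n = t - 1 + i := ⟨n - (t - 1), by omega⟩
    have hci := core i (by omega)
    constructor
    · have h1 := P (t - 1 + i) i (by omega) (by omega) (by omega)
      have h2 := (core (i - 1) (by omega)).1
      have h3 := hsi (i - 1) (t - 1 + i) (by omega) (by omega)
      omega
    · have h1 := P i (t - 1 + i) (by omega) (by omega) (by omega)
      by_cases h4 : i + 1 < t
      · have h2 := (core (i + 1) (by omega)).2
        have h3 := hui (i + 1) (t - 1 + i) (by omega) (by omega)
        omega
      · have h3 := hui 0 (t - 1 + i) (by omega) (by omega)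
        omega
  intro i hi
  by_cases h1 : i < 2 * t - 1
  · exact leaf i h1
  · obtain rfl : k = i + 1 := by omega
    exact ⟨eq_of_forall_lt (hs _ hi) hsi fun j hj => (leaf j (by omega)).1,
      eq_of_forall_lt (hu _ hi) hui fun j hj => (leaf j (by omega)).2⟩

/-- The positions of `1` for row and column sums `2`: a cycle through all rows and columns,
modified in the rows `0` and `4` and the columns `2` and `4`. The only `-1` is in row `0` and
column `2`, and the entries `1` form three paths of different lengths from row `0` to column `2`. -/
def posTwo (k i j : ℕ) : Prop :=
  (j = i ∧ i ≠ 4) ∨ (j = i + 1 ∧ j < k) ∨ (i + 1 = k ∧ j = 0) ∨ (i = 0 ∧ j = 4) ∨ (i = 4 ∧ j = 2)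

/-- The position of `-1` for row and column sums `2`. -/
def negTwo (i j : ℕ) : Prop := i = 0 ∧ j = 2

theorem eq_of_isPatternSymm_two {k : ℕ} (hk : 8 ≤ k) {s u : ℕ → ℕ}
    (h : IsPatternSymm k (posTwo k) negTwo s u) : ∀ i, i < k → s i = i ∧ u i = i := by
  obtain ⟨hs, hu, hsi, hui, -, -, hp, hn⟩ := h
  have P : ∀ i j, i < k → j < k → posTwo k i j → posTwo k (s i) (u j) :=
    fun i j hi hj => (hp i j hi hj).2
  have M : ∀ i j, i < k → j < k → negTwo i j → negTwo (s i) (u j) :=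
    fun i j hi hj => (hn i j hi hj).2
  simp only [posTwo, negTwo] at P M
  obtain ⟨s0, u2⟩ := M 0 2 (by omega) (by omega) (by omega)
  have s1 : s 1 = 1 ∧ u 1 = 1 := by
    have h1 := P 1 1 (by omega) (by omega) (by omega)
    have h2 := P 0 1 (by omega) (by omega) (by omega)
    have h3 := P 1 2 (by omega) (by omega) (by omega)
    have h4 := hui 1 2 (by omega) (by omega)
    rw [s0] at h2
    rw [u2] at h3 h4
    have h5 : s 1 = 0 ∨ s 1 = 1 ∨ s 1 = 2 ∨ s 1 = 4 := by omega
    have h6 := hsi 0 1 (by omega) (by omega)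
    omega
  obtain ⟨s1, u1⟩ := s1
  have s2 : s 2 = 2 := by
    have h1 := P 2 2 (by omega) (by omega) (by omega)
    rw [u2] at h1
    have h2 := hsi 1 2 (by omega) (by omega)
    have h3 : s 2 = 2 ∨ s 2 = 4 := by omega
    rcases h3 with h3 | h3
    · exact h3
    exfalso
    have h4 := P 2 3 (by omega) (by omega) (by omega)
    have h5 := hui 2 3 (by omega) (by omega)
    have h6 : u 3 = 5 := by omega
    have h7 := P 3 3 (by omega) (by omega) (by omega)
    have h8 := hsi 2 3 (by omega) (by omega)
    have h9 : s 3 = 5 := by omega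
    have h10 := P 3 4 (by omega) (by omega) (by omega)
    have h11 := hui 3 4 (by omega) (by omega)
    have h12 : u 4 = 6 := by omega
    have h13 := P 0 4 (by omega) (by omega) (by omega)
    omega
  have u3 : u 3 = 3 := by
    have h4 := P 2 3 (by omega) (by omega) (by omega)
    have h5 := hui 2 3 (by omega) (by omega)
    omega
  have s3 : s 3 = 3 := by
    have h4 := P 3 3 (by omega) (by omega) (by omega)
    have h5 := hsi 2 3 (by omega) (by omega)
    omega
  have u4 : u 4 = 4 := by
    have h4 := P 3 4 (by omega) (by omega) (by omega)
    have h5 := hui 3 4 (by omega) (by omega)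
    omega
  have s4 : s 4 = 4 := by
    have h4 := P 4 2 (by omega) (by omega) (by omega)
    have h5 := hsi 2 4 (by omega) (by omega)
    have h6 := hsi 1 4 (by omega) (by omega)
    omega
  have u5 : u 5 = 5 := by
    have h4 := P 4 5 (by omega) (by omega) (by omega)
    have h5 := hui 2 5 (by omega) (by omega)
    omega
  have chain : ∀ n, n + 4 < k → s (n + 4) = n + 4 ∧ u (n + 4) = n + 4 := by
    intro n
    induction n with
    | zero => exact fun _ => ⟨s4, u4⟩
    | succ n ih =>
      intro hn
      obtain ⟨h1, h2⟩ := ih (by omega)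
      have h3 := P (n + 4) (n + 5) (by omega) (by omega) (by omega)
      have h4 : u (n + 5) = n + 5 := by
        have h5 := hui (n + 4) (n + 5) (by omega) (by omega)
        have h6 := hui 2 (n + 5) (by omega) (by omega)
        omega
      have h5 := P (n + 5) (n + 5) (by omega) (by omega) (by omega)
      change s (n + 5) = n + 5 ∧ u (n + 5) = n + 5
      have h6 := hsi (n + 4) (n + 5) (by omega) (by omega)
      exact ⟨by omega, h4⟩
  have u0 : u 0 = 0 := by
    have h1 := P (k - 1) 0 (by omega) (by omega) (by omega)
    have h2 := chain (k - 5) (by omega)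
    rw [show k - 5 + 4 = k - 1 by omega] at h2
    have h3 := hui 0 (k - 1) (by omega) (by omega)
    omega
  intro i hi
  by_cases h4 : 4 ≤ i
  · have := chain (i - 4) (by omega)
    rwa [Nat.sub_add_cancel h4] at this
  · have : i = 0 ∨ i = 1 ∨ i = 2 ∨ i = 3 := by omega
    rcases this with rfl | rfl | rfl | rfl
    · exact ⟨s0, u0⟩
    · exact ⟨s1, u1⟩
    · exact ⟨s2, u2⟩
    · exact ⟨s3, u3⟩

/-- The positions of `1` in the cycle through all rows and columns, whose bipartite graph is the
cycle with `2 * k` vertices. -/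
def posCycle (k i j : ℕ) : Prop := j = i ∨ (j = i + 1 ∧ j < k) ∨ (i + 1 = k ∧ j = 0)

theorem eq_of_isPatternSymm_cycle {k : ℕ} {s u : ℕ → ℕ} {Neg : ℕ → ℕ → Prop}
    (h : IsPatternSymm k (posCycle k) Neg s u) (s0 : s 0 = 0) (u0 : u 0 = 0) :
    ∀ i, i < k → s i = i ∧ u i = i := by
  obtain ⟨hs, hu, hsi, hui, -, -, hp, -⟩ := h
  have P : ∀ i j, i < k → j < k → posCycle k i j → posCycle k (s i) (u j) :=
    fun i j hi hj => (hp i j hi hj).2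
  simp only [posCycle] at P
  intro i
  induction i with
  | zero => exact fun _ => ⟨s0, u0⟩
  | succ n ih =>
    intro hn
    obtain ⟨h1, h2⟩ := ih (by omega)
    have h3 := P n (n + 1) (by omega) (by omega) (by omega)
    have h4 := hui n (n + 1) (by omega) (by omega)
    have h5 : u (n + 1) = n + 1 := by omega
    have h6 := P (n + 1) (n + 1) (by omega) (by omega) (by omega)
    have h7 := hsi n (n + 1) (by omega) (by omega)
    exact ⟨by omega, h5⟩

/-! ### Asymmetric regular bipartite graphs -/

/-- The rows `0` to `3` of a circulant band of width `r` are modified; for `i ≥ 4` row `i` is the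
cyclic interval of length `r` that starts at column `i`. -/
def posBand (k r i j : ℕ) : Prop :=
  (i = 0 ∧ ((1 ≤ j ∧ j < r) ∨ j = r + 1)) ∨ (i = 1 ∧ 1 ≤ j ∧ j ≤ r) ∨
    (i = 2 ∧ ((2 ≤ j ∧ j ≤ r) ∨ j = r + 2)) ∨ (i = 3 ∧ (j = 0 ∨ (3 ≤ j ∧ j ≤ r + 1))) ∨
    (4 ≤ i ∧ ((i ≤ j ∧ j < i + r) ∨ j + k < i + r))

theorem posBand_of_four_le {k r i j : ℕ} (hi : 4 ≤ i) :
    posBand k r i j ↔ (i ≤ j ∧ j < i + r) ∨ j + k < i + r := by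
  unfold posBand; omega

/-- Row `i` has at most one entry outside row `i'`. -/
def AlmostContained (k r i i' : ℕ) : Prop :=
  ∃ x, ∀ z, z < k → posBand k r i z → posBand k r i' z ∨ z = x

theorem not_almostContained {k r i i' : ℕ} (z₁ z₂ : ℕ) (h₁ : z₁ < k) (h₂ : z₂ < k) (hne : z₁ ≠ z₂)
    (p₁ : posBand k r i z₁) (p₂ : posBand k r i z₂) (n₁ : ¬ posBand k r i' z₁)
    (n₂ : ¬ posBand k r i' z₂) : ¬ AlmostContained k r i i' := by
  rintro ⟨x, hx⟩
  rcases hx z₁ h₁ p₁ with h | rfl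
  · exact n₁ h
  rcases hx z₂ h₂ p₂ with h | rfl
  · exact n₂ h
  exact hne rfl

/-- The pairs of rows that differ by the exchange of a single entry form a path on the rows
`0, 1, 2` and a path on the rows from `4` on. -/
theorem almostContained_iff {k r i i' : ℕ} (hk : 8 ≤ k) (hr : 3 ≤ r) (hrk : 2 * r ≤ k) (hi : i < k)
    (hi' : i' < k) (hne : i ≠ i') : AlmostContained k r i i' ↔
      (i = 0 ∧ i' = 1) ∨ (i = 1 ∧ i' = 0) ∨ (i = 1 ∧ i' = 2) ∨ (i = 2 ∧ i' = 1) ∨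
        (4 ≤ i ∧ i' = i + 1) ∨ (4 ≤ i' ∧ i = i' + 1) := by
  constructor
  · intro h
    by_contra hno
    revert h
    have small : i < 4 → i = 0 ∨ i = 1 ∨ i = 2 ∨ i = 3 := by omega
    have small' : i' < 4 → i' = 0 ∨ i' = 1 ∨ i' = 2 ∨ i' = 3 := by omega
    by_cases h4 : 4 ≤ i
    · by_cases h4' : 4 ≤ i'
      · rcases lt_or_gt_of_ne hne with hlt | hlt
        · by_cases hw : i' + r ≤ i + k
          · apply not_almostContained i (i + 1) <;> (try unfold posBand) <;> omega
          · apply not_almostContained (i + r - 1) (i + r - 2) <;> (try unfold posBand) <;> omega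
        · by_cases hw : i + r ≤ i' + k
          · by_cases hw1 : i + r ≤ k
            · apply not_almostContained (i + r - 1) (i + r - 2) <;> (try unfold posBand) <;> omega
            · by_cases hw2 : i + r = k + 1
              · apply not_almostContained 0 (k - 1) <;> (try unfold posBand) <;> omega
              · apply not_almostContained (i + r - 1 - k) (i + r - 2 - k) <;>
                  (try unfold posBand) <;> omega
          · by_cases hw1 : i + 1 < k
            · apply not_almostContained i (i + 1) <;> (try unfold posBand) <;> omega
            · apply not_almostContained i 0 <;> (try unfold posBand) <;> omega
      · rcases small' (by omega) with rfl | rfl | rfl | rfl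
        · by_cases hw : i + r ≤ k
          · apply not_almostContained (i + r - 1) (i + r - 2) <;> (try unfold posBand) <;> omega
          · apply not_almostContained 0 (k - 1) <;> (try unfold posBand) <;> omega
        · by_cases hw : i + r ≤ k
          · apply not_almostContained (i + r - 1) (i + r - 2) <;> (try unfold posBand) <;> omega
          · apply not_almostContained 0 (k - 1) <;> (try unfold posBand) <;> omega
        · by_cases hw : i + r ≤ k
          · by_cases h5 : i = 4
            · apply not_almostContained (i + r - 1) (i + r - 3) <;> (try unfold posBand) <;> omega
            · apply not_almostContained (i + r - 1) (i + r - 2) <;> (try unfold posBand) <;> omega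
          · apply not_almostContained 0 (k - 1) <;> (try unfold posBand) <;> omega
        · by_cases hw : i + r ≤ k
          · apply not_almostContained (i + r - 1) (i + r - 2) <;> (try unfold posBand) <;> omega
          · by_cases h5 : i + 1 = k
            · apply not_almostContained 1 (k - 1) <;> (try unfold posBand) <;> omega
            · apply not_almostContained (k - 2) (k - 1) <;> (try unfold posBand) <;> omega
    · by_cases h4' : 4 ≤ i'
      · rcases small (by omega) with rfl | rfl | rfl | rfl
        · by_cases hw : i' + r ≤ k + 1
          · apply not_almostContained 1 2 <;> (try unfold posBand) <;> omega
          · apply not_almostContained (r - 1) (r + 1) <;> (try unfold posBand) <;> omega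
        · by_cases hw : i' + r ≤ k
          · apply not_almostContained 1 2 <;> (try unfold posBand) <;> omega
          · apply not_almostContained (r - 1) r <;> (try unfold posBand) <;> omega
        · by_cases hw : i' + r ≤ k
          · apply not_almostContained 2 3 <;> (try unfold posBand) <;> omega
          · apply not_almostContained (r - 1) r <;> (try unfold posBand) <;> omega
        · by_cases hw : i' + r ≤ k
          · apply not_almostContained 0 3 <;> (try unfold posBand) <;> omega
          · by_cases h5 : r + 2 ≤ i'
            · apply not_almostContained r (r + 1) <;> (try unfold posBand) <;> omega
            · apply not_almostContained (r - 1) r <;> (try unfold posBand) <;> omega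
      · rcases small (by omega) with rfl | rfl | rfl | rfl <;>
          rcases small' (by omega) with rfl | rfl | rfl | rfl
        · omega
        · omega
        · apply not_almostContained 1 (r + 1) <;> (try unfold posBand) <;> omega
        · apply not_almostContained 1 2 <;> (try unfold posBand) <;> omega
        · omega
        · omega
        · omega
        · apply not_almostContained 1 2 <;> (try unfold posBand) <;> omega
        · apply not_almostContained r (r + 2) <;> (try unfold posBand) <;> omega
        · omega
        · omega
        · apply not_almostContained 2 (r + 2) <;> (try unfold posBand) <;> omega
        · apply not_almostContained 0 r <;> (try unfold posBand) <;> omega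
        · apply not_almostContained 0 (r + 1) <;> (try unfold posBand) <;> omega
        · apply not_almostContained 0 (r + 1) <;> (try unfold posBand) <;> omega
        · omega
  · rintro (⟨rfl, rfl⟩ | ⟨rfl, rfl⟩ | ⟨rfl, rfl⟩ | ⟨rfl, rfl⟩ | ⟨h4, rfl⟩ | ⟨h4, rfl⟩)
    · exact ⟨r + 1, fun z hz => by unfold posBand; omega⟩
    · exact ⟨r, fun z hz => by unfold posBand; omega⟩
    · exact ⟨1, fun z hz => by unfold posBand; omega⟩
    · exact ⟨r + 2, fun z hz => by unfold posBand; omega⟩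
    · exact ⟨i, fun z hz => by unfold posBand; omega⟩
    · by_cases h : i' + r < k
      · exact ⟨i' + r, fun z hz => by unfold posBand; omega⟩
      · exact ⟨i' + r - k, fun z hz => by unfold posBand; omega⟩

theorem almostContained_of_isPatternSymm {k r : ℕ} {Neg : ℕ → ℕ → Prop} {s u : ℕ → ℕ}
    (h : IsPatternSymm k (posBand k r) Neg s u) {i i' : ℕ} (hi : i < k) (hi' : i' < k)
    (hc : AlmostContained k r i i') : AlmostContained k r (s i) (s i') := by
  obtain ⟨x, hx⟩ := hc
  refine ⟨u x, fun z hz hp => ?_⟩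
  obtain ⟨y, hy, rfl⟩ := h.u_surj z hz
  rw [h.pos i y hi hy] at hp
  rw [h.pos i' y hi' hy]
  exact (hx y hy hp).imp_right fun he => congrArg u he

/-- A set of three entries of row `i` outside row `i'` rules out that at most two entries of the
preimage of row `i` lie outside the preimage of row `i'`. -/
theorem false_of_three {k r : ℕ} {Neg : ℕ → ℕ → Prop} {s u : ℕ → ℕ}
    (h : IsPatternSymm k (posBand k r) Neg s u) {i i' x y : ℕ} (hi : i < k) (hi' : i' < k)
    (hxy : ∀ z, z < k → posBand k r i z → posBand k r i' z ∨ z = x ∨ z = y) (z₁ z₂ z₃ : ℕ)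
    (h12 : z₁ < z₂) (h23 : z₂ < z₃) (h3 : z₃ < k) (p₁ : posBand k r (s i) z₁)
    (p₂ : posBand k r (s i) z₂) (p₃ : posBand k r (s i) z₃) (n₁ : ¬ posBand k r (s i') z₁)
    (n₂ : ¬ posBand k r (s i') z₂) (n₃ : ¬ posBand k r (s i') z₃) : False := by
  have key : ∀ z, z < k → posBand k r (s i) z → ¬ posBand k r (s i') z → z = u x ∨ z = u y := by
    intro z hz hp hn
    obtain ⟨w, hw, rfl⟩ := h.u_surj z hz
    rw [h.pos i w hi hw] at hp
    rw [h.pos i' w hi' hw] at hn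
    rcases hxy w hw hp with h' | rfl | rfl
    · exact absurd h' hn
    · exact Or.inl rfl
    · exact Or.inr rfl
  have k1 := key z₁ (by omega) p₁ n₁
  have k2 := key z₂ (by omega) p₂ n₂
  have k3 := key z₃ h3 p₃ n₃
  omega

theorem not_posBand_col_iff {k r a b : ℕ} (hk : 8 ≤ k) (hr : 3 ≤ r) (hrk : 2 * r ≤ k)
    (ha : a < k) (hb : b < 4) (h4 : 4 ≤ a) :
    ¬ ∀ i, i < k → (posBand k r i b ↔ posBand k r i a) := by
  intro hc
  by_cases h5 : a + 1 < k
  · have e1 := hc a ha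
    have e2 := hc (a + 1) h5
    rw [posBand_of_four_le h4, posBand_of_four_le h4] at e1
    rw [posBand_of_four_le (by omega), posBand_of_four_le (by omega)] at e2
    omega
  · have h0 : posBand k r 0 b ∨ posBand k r 1 b ∨ posBand k r 3 b := by unfold posBand; omega
    rcases h0 with h | h | h
    · have := (hc 0 (by omega)).1 h
      unfold posBand at this
      omega
    · have := (hc 1 (by omega)).1 h
      unfold posBand at this
      omega
    · have := (hc 3 (by omega)).1 h
      unfold posBand at this
      omega

/-- Distinct columns are told apart by the rows `0` to `3` and those starting near them. -/
theorem eq_of_posBand_col_iff {k r j j' : ℕ} (hk : 8 ≤ k) (hr : 3 ≤ r) (hrk : 2 * r ≤ k)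
    (hj : j < k) (hj' : j' < k) (col : ∀ i, i < k → (posBand k r i j' ↔ posBand k r i j)) :
    j' = j := by
  by_cases h4 : 4 ≤ j
  · by_cases h4' : 4 ≤ j'
    · have c4 := col j hj
      have c5 := col j' hj'
      rw [posBand_of_four_le h4, posBand_of_four_le h4] at c4
      rw [posBand_of_four_le h4', posBand_of_four_le h4'] at c5
      omega
    · exact (not_posBand_col_iff hk hr hrk hj (by omega) h4 col).elim
  · by_cases h4' : 4 ≤ j'
    · exact (not_posBand_col_iff hk hr hrk hj' (by omega) h4' fun i hi => (col i hi).symm).elim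
    · have z0 : ∀ b, b < 4 → (posBand k r 0 b ↔ b = 1 ∨ b = 2 ∨ (b = 3 ∧ r ≠ 3)) := fun b hb => by
        unfold posBand; omega
      have z1 : ∀ b, b < 4 → (posBand k r 1 b ↔ b ≠ 0) := fun b hb => by unfold posBand; omega
      have z2 : ∀ b, b < 4 → (posBand k r 2 b ↔ b = 2 ∨ b = 3) := fun b hb => by
        unfold posBand; omega
      have z3 : ∀ b, b < 4 → (posBand k r 3 b ↔ b = 0 ∨ b = 3) := fun b hb => by
        unfold posBand; omega
      have c1 := col 1 (by omega)
      have c2 := col 2 (by omega)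
      have c3 := col 3 (by omega)
      rw [z1 _ (by omega), z1 _ (by omega)] at c1
      rw [z2 _ (by omega), z2 _ (by omega)] at c2
      rw [z3 _ (by omega), z3 _ (by omega)] at c3
      omega

theorem eq_of_isPatternSymm_band {k r : ℕ} (hk : 8 ≤ k) (hr : 3 ≤ r) (hrk : 2 * r ≤ k)
    {s u : ℕ → ℕ} {Neg : ℕ → ℕ → Prop} (h : IsPatternSymm k (posBand k r) Neg s u) :
    ∀ i, i < k → s i = i ∧ u i = i := by
  have H := fun i i' hi hi' hne => almostContained_iff (i := i) (i' := i') hk hr hrk hi hi' hne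
  have HS : ∀ i i', i < k → i' < k → i ≠ i' → AlmostContained k r i i' →
      AlmostContained k r (s i) (s i') ∧ s i ≠ s i' ∧ s i < k ∧ s i' < k := fun i i' hi hi' hne hc =>
    ⟨almostContained_of_isPatternSymm h hi hi' hc, fun he => hne (h.s_inj i i' hi hi' he),
      h.s_lt i hi, h.s_lt i' hi'⟩
  have step : ∀ i i', i < k → i' < k → i ≠ i' → AlmostContained k r i i' →
      (s i = 0 ∧ s i' = 1) ∨ (s i = 1 ∧ s i' = 0) ∨ (s i = 1 ∧ s i' = 2) ∨ (s i = 2 ∧ s i' = 1) ∨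
        (4 ≤ s i ∧ s i' = s i + 1) ∨ (4 ≤ s i' ∧ s i = s i' + 1) := fun i i' hi hi' hne hc => by
    obtain ⟨h1, h2, h3, h4⟩ := HS i i' hi hi' hne hc
    exact (H _ _ h3 h4 h2).1 h1
  have a10 : AlmostContained k r 1 0 := (H 1 0 (by omega) (by omega) (by omega)).2 (by omega)
  have a12 : AlmostContained k r 1 2 := (H 1 2 (by omega) (by omega) (by omega)).2 (by omega)
  have e10 := step 1 0 (by omega) (by omega) (by omega) a10
  have e12 := step 1 2 (by omega) (by omega) (by omega) a12
  have d02 := h.s_inj 0 2 (by omega) (by omega)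
  -- The neighbours `0` and `2` of row `1` have no further neighbour.
  have nonbr : ∀ m x, (m = 0 ∨ m = 2) → x < k → s m ≠ x → AlmostContained k r (s m) x →
      x = s 1 := by
    intro m x hm hx hne hc
    obtain ⟨y, hy, rfl⟩ := h.s_surj x hx
    have hym : m ≠ y := fun he => hne (by rw [he])
    have hm' : m < k := by omega
    obtain ⟨z, hz⟩ := hc
    obtain ⟨hb⟩ : Nonempty (AlmostContained k r m y) := by
      by_cases hzk : ∃ w, w < k ∧ u w = z
      · obtain ⟨w, hw, rfl⟩ := hzk
        refine ⟨w, fun v hv hp => ?_⟩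
        rw [← h.pos m v hm' hv] at hp
        rw [← h.pos y v hy hv]
        exact (hz _ (h.u_lt v hv) hp).imp_right (h.u_inj v w hv hw)
      · refine ⟨0, fun v hv hp => Or.inl ?_⟩
        rw [← h.pos m v hm' hv] at hp
        rw [← h.pos y v hy hv]
        exact (hz _ (h.u_lt v hv) hp).resolve_right fun he => hzk ⟨v, hv, he⟩
    have := (H m y hm' hy hym).1 hb
    have : y = 1 := by omega
    rw [this]
  have s1 : s 1 = 1 := by
    have l0 := h.s_lt 0 (by omega)
    have l1 := h.s_lt 1 (by omega)
    have l2 := h.s_lt 2 (by omega)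
    by_contra hne
    have h4 : 4 ≤ s 0 ∧ 4 ≤ s 1 ∧ 4 ≤ s 2 := by omega
    have big : ∀ m, m = 0 ∨ m = 2 → ¬ (s m = s 1 + 1 ∧ s 1 + 2 < k) ∧
        ¬ (s 1 = s m + 1 ∧ 5 ≤ s m) := by
      intro m hm
      constructor
      · rintro ⟨h5, h6⟩
        have := nonbr m (s 1 + 2) hm h6 (by omega)
          ((H _ _ (by omega) h6 (by omega)).2 (by omega))
        omega
      · rintro ⟨h5, h6⟩
        have := nonbr m (s m - 1) hm (by omega) (by omega)
          ((H _ _ (by omega) (by omega) (by omega)).2 (by omega))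
        omega
    have b0 := big 0 (Or.inl rfl)
    have b2 := big 2 (Or.inr rfl)
    omega
  have s02 : (s 0 = 0 ∧ s 2 = 2) ∨ (s 0 = 2 ∧ s 2 = 0) := by omega
  have sl : s (k - 1) = k - 1 := by
    have l0 := h.s_lt (k - 1) (by omega)
    have e := step (k - 1) (k - 2) (by omega) (by omega) (by omega)
      ((H _ _ (by omega) (by omega) (by omega)).2 (by omega))
    have d0 := h.s_inj 0 (k - 1) (by omega) (by omega)
    have d1 := h.s_inj 1 (k - 1) (by omega) (by omega)
    have d2 := h.s_inj 2 (k - 1) (by omega) (by omega)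
    by_contra hne
    have h4 : 4 ≤ s (k - 1) := by omega
    have h5 : s (k - 1) < k - 1 := by omega
    have hxy : ∀ z, z < k → posBand k r 1 z → posBand k r (k - 1) z ∨ z = r - 1 ∨ z = r := by
      intro z hz
      unfold posBand
      omega
    generalize hx : s (k - 1) = x at *
    by_cases hw : x + r ≤ k
    · refine false_of_three h (i := 1) (i' := k - 1) (by omega) (by omega) hxy 1 2 3
        (by omega) (by omega) (by omega) ?_ ?_ ?_ ?_ ?_ ?_ <;> simp only [s1, hx] <;>
        unfold posBand <;> omega
    · refine false_of_three h (i := 1) (i' := k - 1) (by omega) (by omega) hxy (r - 2) (r - 1) r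
        (by omega) (by omega) (by omega) ?_ ?_ ?_ ?_ ?_ ?_ <;> simp only [s1, hx] <;>
        unfold posBand <;> omega
  have s0 : s 0 = 0 ∧ s 2 = 2 := by
    refine s02.resolve_right fun hs => ?_
    have hxy : ∀ z, z < k → posBand k r 0 z → posBand k r (k - 1) z ∨ z = r - 1 ∨ z = r + 1 := by
      intro z hz
      unfold posBand
      omega
    refine false_of_three h (i := 0) (i' := k - 1) (by omega) (by omega) hxy (r - 1) r (r + 2)
        (by omega) (by omega) (by omega) ?_ ?_ ?_ ?_ ?_ ?_ <;> simp only [hs.1, sl] <;>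
        unfold posBand <;> omega
  have tail : ∀ n, n + 6 ≤ k → s (k - 1 - n) = k - 1 - n ∧ s (k - 2 - n) = k - 2 - n := by
    intro n
    induction n with
    | zero =>
      intro _
      have e := step (k - 1) (k - 2) (by omega) (by omega) (by omega)
        ((H _ _ (by omega) (by omega) (by omega)).2 (by omega))
      have l := h.s_lt (k - 2) (by omega)
      exact ⟨sl, by rw [Nat.sub_zero]; omega⟩
    | succ n ih =>
      intro hn
      obtain ⟨h1, h2⟩ := ih (by omega)
      obtain ⟨m, hm⟩ : ∃ m, m + n + 3 = k := ⟨k - n - 3, by omega⟩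
      rw [show k - 1 - n = m + 2 by omega] at h1
      rw [show k - 2 - n = m + 1 by omega] at h2
      rw [show k - 1 - (n + 1) = m + 1 by omega, show k - 2 - (n + 1) = m by omega]
      refine ⟨h2, ?_⟩
      have e := step (m + 1) m (by omega) (by omega) (by omega)
        ((H _ _ (by omega) (by omega) (by omega)).2 (by omega))
      have d := h.s_inj (m + 2) m (by omega) (by omega)
      omega
  have sall : ∀ i, i < k → s i = i := by
    have s4 : ∀ i, 4 ≤ i → i < k → s i = i := fun i h4 hi => by
      by_cases h5 : i + 1 = k
      · obtain rfl : i = k - 1 := by omega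
        exact sl
      · have := (tail (k - 2 - i) (by omega)).2
        rwa [show k - 2 - (k - 2 - i) = i by omega] at this
    intro i hi
    by_cases h4 : 4 ≤ i
    · exact s4 i h4 hi
    · have : i = 0 ∨ i = 1 ∨ i = 2 ∨ i = 3 := by omega
      rcases this with rfl | rfl | rfl | rfl
      · exact s0.1
      · exact s1
      · exact s0.2
      · by_contra hne
        have l := h.s_lt 3 hi
        have d := h.s_inj (s 3) 3 l hi
        by_cases h5 : 4 ≤ s 3
        · exact hne (d (s4 _ h5 l))
        · have : s 3 = 0 ∨ s 3 = 1 ∨ s 3 = 2 := by omega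
          rcases this with h6 | h6 | h6 <;> rw [h6] at d
          · exact absurd (d s0.1) (by omega)
          · exact absurd (d s1) (by omega)
          · exact absurd (d s0.2) (by omega)
  intro j hj
  refine ⟨sall j hj, eq_of_posBand_col_iff hk hr hrk hj (h.u_lt j hj) fun i hi => ?_⟩
  have := h.pos i j hi hj
  rwa [sall i hi] at this

/-! ### Asymmetric matrices from sign patterns -/

/-- There is a `k × k` matrix with entries in `{-1, 0, 1}`, all row and column sums equal to `r`,
exactly `t` entries `-1`, and no symmetry but the identity. -/
def HasAsymmetricMatrix (k : ℕ) (r : ℤ) (t : ℕ) : Prop :=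
  ∃ B : Fin k → Fin k → ℤ, (∀ i j, B i j = 0 ∨ B i j = 1 ∨ B i j = -1) ∧ (∀ i, ∑ j, B i j = r) ∧
    (∀ j, ∑ i, B i j = r) ∧ ∑ i, ∑ j, (-B i j).toNat = t ∧ Nat.card (matrixSymm B) = 1

open Classical in
/-- The `k × k` matrix with entries `1` at the positions in `Pos` and `-1` at those in `Neg`. -/
noncomputable def signMatrix (k : ℕ) (Pos Neg : ℕ → ℕ → Prop) : Fin k → Fin k → ℤ :=
  fun i j => if Pos i j then 1 else if Neg i j then -1 else 0

/-- A permutation of `Fin k` as a function on natural numbers, the identity from `k` on. -/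
def natPerm {k : ℕ} (σ : Equiv.Perm (Fin k)) (i : ℕ) : ℕ := if h : i < k then σ ⟨i, h⟩ else i

theorem natPerm_val {k : ℕ} (σ : Equiv.Perm (Fin k)) (i : Fin k) : natPerm σ i = σ i := by
  simp [natPerm]

theorem natPerm_lt {k : ℕ} (σ : Equiv.Perm (Fin k)) (i : ℕ) (hi : i < k) : natPerm σ i < k := by
  rw [natPerm, dif_pos hi]; exact (σ _).2

theorem natPerm_inj {k : ℕ} (σ : Equiv.Perm (Fin k)) (i i' : ℕ) (hi : i < k) (hi' : i' < k)
    (h : natPerm σ i = natPerm σ i') : i = i' := by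
  have h3 : σ ⟨i, hi⟩ = σ ⟨i', hi'⟩ := Fin.ext (by rw [← natPerm_val, ← natPerm_val]; exact h)
  exact congrArg Fin.val (σ.injective h3)

theorem natPerm_surj {k : ℕ} (σ : Equiv.Perm (Fin k)) (i : ℕ) (hi : i < k) :
    ∃ i', i' < k ∧ natPerm σ i' = i :=
  ⟨σ.symm ⟨i, hi⟩, (σ.symm ⟨i, hi⟩).2, by rw [natPerm_val, Equiv.apply_symm_apply]⟩

theorem isPatternSymm_of_mem {k : ℕ} {Pos Neg : ℕ → ℕ → Prop} (hd : ∀ i j, Pos i j → ¬ Neg i j)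
    {g : Equiv.Perm (Fin k) × Equiv.Perm (Fin k)} (hg : g ∈ matrixSymm (signMatrix k Pos Neg)) :
    IsPatternSymm k Pos Neg (natPerm g.1) (natPerm g.2) := by
  have h1 : ∀ i j : Fin k, signMatrix k Pos Neg i j = 1 ↔ Pos i j := fun i j => by
    unfold signMatrix; split_ifs <;> simp_all
  have h2 : ∀ i j : Fin k, signMatrix k Pos Neg i j = -1 ↔ Neg i j := fun i j => by
    have := hd i j
    unfold signMatrix; split_ifs <;> simp_all
  refine ⟨natPerm_lt _, natPerm_lt _, natPerm_inj _, natPerm_inj _, natPerm_surj _,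
    natPerm_surj _, fun i j hi hj => ?_, fun i j hi hj => ?_⟩
  · have := hg ⟨i, hi⟩ ⟨j, hj⟩
    have h3 := h1 (g.1 ⟨i, hi⟩) (g.2 ⟨j, hj⟩)
    rw [this, h1, ← natPerm_val, ← natPerm_val] at h3
    exact h3.symm
  · have := hg ⟨i, hi⟩ ⟨j, hj⟩
    have h3 := h2 (g.1 ⟨i, hi⟩) (g.2 ⟨j, hj⟩)
    rw [this, h2, ← natPerm_val, ← natPerm_val] at h3
    exact h3.symm

theorem eq_one_of_natPerm {k : ℕ} {σ : Equiv.Perm (Fin k)} (h : ∀ i, i < k → natPerm σ i = i) :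
    σ = 1 :=
  Equiv.ext fun i => Fin.ext (by rw [← natPerm_val, h i i.2]; rfl)

open Classical in
/-- The number of indices below `k` that satisfy `P`. -/
noncomputable def cnt (k : ℕ) (P : ℕ → Prop) : ℕ := ((Finset.range k).filter P).card

open Classical in
theorem sum_ite_eq_cnt (k : ℕ) (P : ℕ → Prop) :
    ∑ j : Fin k, (if P j then 1 else 0) = cnt k P := by
  rw [Fin.sum_univ_eq_sum_range (fun j => if P j then 1 else 0) k, cnt, Finset.card_filter]

theorem cnt_eq_of_iff {k a b c d : ℕ} {P : ℕ → Prop}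
    (h : ∀ j, j < k → (P j ↔ (a ≤ j ∧ j < b) ∨ (c ≤ j ∧ j < d))) (hbc : b ≤ c) (hb : b ≤ k)
    (hd : d ≤ k) : cnt k P = (b - a) + (d - c) := by
  classical
  have : (Finset.range k).filter P = Finset.Ico a b ∪ Finset.Ico c d := by
    ext j
    simp only [Finset.mem_filter, Finset.mem_range, Finset.mem_union, Finset.mem_Ico]
    constructor
    · rintro ⟨h1, h2⟩; exact (h j h1).1 h2
    · intro h1
      have h2 : j < k := by omega
      exact ⟨h2, (h j h2).2 h1⟩
  rw [cnt]
  have e : ((Finset.range k).filter P) = Finset.Ico a b ∪ Finset.Ico c d := this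
  rw [show (Finset.filter P (Finset.range k)).card = (Finset.Ico a b ∪ Finset.Ico c d).card by
    rw [← e], Finset.card_union_of_disjoint, Nat.card_Ico, Nat.card_Ico]
  rw [Finset.disjoint_left]
  intro j h1 h2
  rw [Finset.mem_Ico] at h1 h2
  omega

theorem cnt_eq_zero {k : ℕ} {P : ℕ → Prop} (h : ∀ j, j < k → ¬ P j) : cnt k P = 0 := by
  rw [cnt_eq_of_iff (a := 0) (b := 0) (c := 0) (d := 0) (fun j hj => by simp [h j hj])] <;> omega

theorem cnt_eq_one {k : ℕ} {P : ℕ → Prop} (n : ℕ) (hn : n < k) (h : ∀ j, j < k → (P j ↔ j = n)) :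
    cnt k P = 1 := by
  rw [cnt_eq_of_iff (a := n) (b := n + 1) (c := k) (d := k)
    (fun j hj => (h j hj).trans (by omega))] <;> omega

theorem cnt_eq_two {k : ℕ} {P : ℕ → Prop} (m n : ℕ) (hmn : m < n) (hn : n < k)
    (h : ∀ j, j < k → (P j ↔ j = m ∨ j = n)) : cnt k P = 2 := by
  rw [cnt_eq_of_iff (a := m) (b := m + 1) (c := n) (d := n + 1)
    (fun j hj => (h j hj).trans (by omega))] <;> omega

theorem hasAsymmetricMatrix_of_pattern {k r t : ℕ} {Pos Neg : ℕ → ℕ → Prop}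
    (hd : ∀ i j, Pos i j → ¬ Neg i j)
    (hrow : ∀ i, i < k → cnt k (fun j => Pos i j) = cnt k (fun j => Neg i j) + r)
    (hcol : ∀ j, j < k → cnt k (fun i => Pos i j) = cnt k (fun i => Neg i j) + r)
    (ht : ∑ i : Fin k, cnt k (fun j => Neg i j) = t)
    (hrigid : ∀ s u, IsPatternSymm k Pos Neg s u → ∀ i, i < k → s i = i ∧ u i = i) :
    HasAsymmetricMatrix k r t := by
  classical
  have hsub : ∀ i j : Fin k, signMatrix k Pos Neg i j =
      ((if Pos i j then 1 else 0 : ℕ) : ℤ) - ((if Neg i j then 1 else 0 : ℕ) : ℤ) := fun i j => by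
    have := hd i j
    unfold signMatrix; split_ifs <;> simp_all
  have hneg : ∀ i j : Fin k, (-signMatrix k Pos Neg i j).toNat = if Neg i j then 1 else 0 :=
    fun i j => by
      have := hd i j
      unfold signMatrix; split_ifs <;> simp_all
  have hcnt : ∀ P : ℕ → Prop, ∑ j : Fin k, (if P j then 1 else 0) = cnt k P := fun P => by
    rw [← sum_ite_eq_cnt]
  refine ⟨signMatrix k Pos Neg, fun i j => ?_, fun i => ?_, fun j => ?_, ?_, ?_⟩
  · unfold signMatrix; split_ifs <;> simp
  · simp only [hsub]
    rw [Finset.sum_sub_distrib, ← Nat.cast_sum, ← Nat.cast_sum, hcnt fun j => Pos i j,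
      hcnt fun j => Neg i j, hrow i i.2]
    push_cast; ring
  · simp only [hsub]
    rw [Finset.sum_sub_distrib, ← Nat.cast_sum, ← Nat.cast_sum, hcnt fun i => Pos i j,
      hcnt fun i => Neg i j, hcol j j.2]
    push_cast; ring
  · simp only [hneg]
    rw [← ht]
    exact Finset.sum_congr rfl fun i _ => hcnt fun j => Neg i j
  · rw [Nat.card_eq_one_iff_unique]
    refine ⟨⟨fun g g' => ?_⟩, ⟨1⟩⟩
    have key : ∀ g : matrixSymm (signMatrix k Pos Neg), g.1 = 1 := fun g => by
      have h := hrigid _ _ (isPatternSymm_of_mem hd g.2)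
      exact Prod.ext (eq_one_of_natPerm fun i hi => (h i hi).1)
        (eq_one_of_natPerm fun i hi => (h i hi).2)
    exact Subtype.ext ((key g).trans (key g').symm)

theorem hasAsymmetricMatrix_zero {k : ℕ} (hk : 8 ≤ k) : HasAsymmetricMatrix k 0 k := by
  have hneg : ∀ i, i < k → cnt k (fun j => negZero k i j) =
      if i = 0 then 2 else if i + 1 = k then 0 else 1 := by
    intro i hi
    split_ifs with h0 h1
    · exact cnt_eq_two 1 2 (by omega) (by omega) fun j hj => by unfold negZero; omega
    · exact cnt_eq_zero fun j hj => by unfold negZero; omega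
    · by_cases h2 : i + 2 = k
      · exact cnt_eq_one 0 (by omega) fun j hj => by unfold negZero; omega
      · exact cnt_eq_one (i + 1) (by omega) fun j hj => by unfold negZero; omega
  refine hasAsymmetricMatrix_of_pattern (r := 0) (Pos := posZero k) (Neg := negZero k)
    (fun i j => by unfold posZero negZero; omega) (fun i hi => ?_) (fun j hj => ?_) ?_
    (fun s u => eq_of_isPatternSymm_zero hk)
  · rw [hneg i hi]
    split_ifs with h0 h1
    · exact cnt_eq_two 0 3 (by omega) (by omega) fun j hj => by unfold posZero; omega
    · exact cnt_eq_zero fun j hj => by unfold posZero; omega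
    · by_cases h2 : i = 3
      · exact cnt_eq_one 2 (by omega) fun j hj => by unfold posZero; omega
      · exact cnt_eq_one i (by omega) fun j hj => by unfold posZero; omega
  · by_cases h2 : j = 2
    · rw [cnt_eq_two 2 3 (by omega) (by omega) fun i hi => by unfold posZero; omega,
        cnt_eq_two 0 1 (by omega) (by omega) fun i hi => by unfold negZero; omega]
    by_cases h3 : j = 3
    · rw [cnt_eq_one 0 (by omega) fun i hi => by unfold posZero; omega,
        cnt_eq_one 2 (by omega) fun i hi => by unfold negZero; omega]
    by_cases h0 : j = 0
    · rw [cnt_eq_one 0 (by omega) fun i hi => by unfold posZero; omega,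
        cnt_eq_one (k - 2) (by omega) fun i hi => by unfold negZero; omega]
    by_cases h1 : j + 1 = k
    · rw [cnt_eq_zero fun i hi => by unfold posZero; omega,
        cnt_eq_zero fun i hi => by unfold negZero; omega]
    · rw [cnt_eq_one j (by omega) fun i hi => by unfold posZero; omega,
        cnt_eq_one (j - 1) (by omega) fun i hi => by unfold negZero; omega]
  · rw [Finset.sum_congr rfl fun (i : Fin k) _ => hneg i i.2]
    obtain ⟨n, rfl⟩ : ∃ n, k = n + 2 := ⟨k - 2, by omega⟩
    rw [Fin.sum_univ_succ, Fin.sum_univ_castSucc]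
    have : ∀ i : Fin n, (if (i.castSucc.succ : ℕ) = 0 then 2 else
        if (i.castSucc.succ : ℕ) + 1 = n + 2 then 0 else 1) = 1 := fun i => by
      have := i.2
      simp; omega
    simp only [this]
    simp
    omega

theorem hasAsymmetricMatrix_one {k : ℕ} (hk : 8 ≤ k) : HasAsymmetricMatrix k 1 ((k + 1) / 2) := by
  obtain ⟨t, ht⟩ : ∃ t, t = (k + 1) / 2 := ⟨_, rfl⟩
  rw [← ht]
  have hneg : ∀ i, i < k → cnt k (fun j => negOne t i j) = if i < t then 1 else 0 := by
    intro i hi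
    split_ifs with h0
    · by_cases h1 : i + 1 = t
      · exact cnt_eq_one 1 (by omega) fun j hj => by unfold negOne; omega
      by_cases h2 : i + 2 = t
      · exact cnt_eq_one 0 (by omega) fun j hj => by unfold negOne; omega
      · exact cnt_eq_one (i + 2) (by omega) fun j hj => by unfold negOne; omega
    · exact cnt_eq_zero fun j hj => by unfold negOne; omega
  refine hasAsymmetricMatrix_of_pattern (r := 1) (Pos := posOne t) (Neg := negOne t)
    (fun i j => by unfold posOne negOne; omega) (fun i hi => ?_) (fun j hj => ?_) ?_
    (fun s u => eq_of_isPatternSymm_one (by omega) (by omega))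
  · rw [hneg i hi]
    split_ifs with h0
    · by_cases h1 : i = 0
      · exact cnt_eq_two 0 1 (by omega) (by omega) fun j hj => by unfold posOne; omega
      by_cases h2 : i + 1 = t
      · exact cnt_eq_two 0 (t + i - 1) (by omega) (by omega) fun j hj => by unfold posOne; omega
      · exact cnt_eq_two (i + 1) (t + i - 1) (by omega) (by omega) fun j hj => by
          unfold posOne; omega
    · by_cases h1 : i + 1 = 2 * t
      · exact cnt_eq_one i (by omega) fun j hj => by unfold posOne; omega
      · exact cnt_eq_one (i + 1 - t) (by omega) fun j hj => by unfold posOne; omega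
  · by_cases h0 : j = 0
    · rw [cnt_eq_two 0 (t - 1) (by omega) (by omega) fun i hi => by unfold posOne; omega,
        cnt_eq_one (t - 2) (by omega) fun i hi => by unfold negOne; omega]
    by_cases h1 : j = 1
    · rw [cnt_eq_two 0 t (by omega) (by omega) fun i hi => by unfold posOne; omega,
        cnt_eq_one (t - 1) (by omega) fun i hi => by unfold negOne; omega]
    by_cases h2 : j < t
    · rw [cnt_eq_two (j - 1) (t + j - 1) (by omega) (by omega) fun i hi => by
          unfold posOne; omega,
        cnt_eq_one (j - 2) (by omega) fun i hi => by unfold negOne; omega]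
    by_cases h3 : j + 1 = 2 * t
    · rw [cnt_eq_one j (by omega) fun i hi => by unfold posOne; omega,
        cnt_eq_zero fun i hi => by unfold negOne; omega]
    · rw [cnt_eq_one (j + 1 - t) (by omega) fun i hi => by unfold posOne; omega,
        cnt_eq_zero fun i hi => by unfold negOne; omega]
  · rw [Finset.sum_congr rfl fun (i : Fin k) _ => hneg i i.2,
      Fin.sum_univ_eq_sum_range (fun i => if i < t then 1 else 0) k, ← Finset.card_filter]
    have : (Finset.range k).filter (fun i => i < t) = Finset.range t := by
      ext i; simp only [Finset.mem_filter, Finset.mem_range]; omega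
    rw [this, Finset.card_range]

theorem hasAsymmetricMatrix_two {k : ℕ} (hk : 8 ≤ k) : HasAsymmetricMatrix k 2 1 := by
  have hneg : ∀ i, i < k → cnt k (fun j => negTwo i j) = if i = 0 then 1 else 0 := by
    intro i hi
    split_ifs with h0
    · exact cnt_eq_one 2 (by omega) fun j hj => by unfold negTwo; omega
    · exact cnt_eq_zero fun j hj => by unfold negTwo; omega
  refine hasAsymmetricMatrix_of_pattern (r := 2) (Pos := posTwo k) (Neg := negTwo)
    (fun i j => by unfold posTwo negTwo; omega) (fun i hi => ?_) (fun j hj => ?_) ?_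
    (fun s u => eq_of_isPatternSymm_two hk)
  · rw [hneg i hi]
    split_ifs with h0
    · exact cnt_eq_of_iff (a := 0) (b := 2) (c := 4) (d := 5)
        (fun j hj => by unfold posTwo; omega) (by omega) (by omega) (by omega)
    · by_cases h1 : i = 4
      · exact cnt_eq_two 2 5 (by omega) (by omega) fun j hj => by unfold posTwo; omega
      by_cases h2 : i + 1 = k
      · exact cnt_eq_two 0 i (by omega) (by omega) fun j hj => by unfold posTwo; omega
      · exact cnt_eq_two i (i + 1) (by omega) (by omega) fun j hj => by unfold posTwo; omega
  · by_cases h2 : j = 2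
    · rw [cnt_eq_of_iff (a := 1) (b := 3) (c := 4) (d := 5)
          (fun i hi => by unfold posTwo; omega) (by omega) (by omega) (by omega),
        cnt_eq_one 0 (by omega) fun i hi => by unfold negTwo; omega]
    · rw [cnt_eq_zero (P := fun i => negTwo i j) fun i hi => by unfold negTwo; omega]
      by_cases h0 : j = 0
      · exact cnt_eq_two 0 (k - 1) (by omega) (by omega) fun i hi => by unfold posTwo; omega
      by_cases h4 : j = 4
      · exact cnt_eq_two 0 3 (by omega) (by omega) fun i hi => by unfold posTwo; omega
      · exact cnt_eq_two (j - 1) j (by omega) (by omega) fun i hi => by unfold posTwo; omega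
  · rw [Finset.sum_congr rfl fun (i : Fin k) _ => hneg i i.2]
    obtain ⟨n, rfl⟩ : ∃ n, k = n + 1 := ⟨k - 1, by omega⟩
    rw [Fin.sum_univ_succ]
    simp

theorem hasAsymmetricMatrix_band {k r : ℕ} (hk : 8 ≤ k) (hr : 3 ≤ r) (hrk : 2 * r ≤ k) :
    HasAsymmetricMatrix k r 0 := by
  have hneg : ∀ i, cnt k (fun _ => (fun _ _ => False : ℕ → ℕ → Prop) i i) = 0 := fun i =>
    cnt_eq_zero fun _ _ h => h
  refine hasAsymmetricMatrix_of_pattern (r := r) (Pos := posBand k r) (Neg := fun _ _ => False)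
    (fun _ _ _ h => h) (fun i hi => ?_) (fun j hj => ?_)
    (Finset.sum_eq_zero fun i _ => hneg i) (fun s u => eq_of_isPatternSymm_band hk hr hrk)
  · rw [hneg i, zero_add]
    by_cases h0 : i = 0
    · rw [cnt_eq_of_iff (a := 1) (b := r) (c := r + 1) (d := r + 2)
        (fun j hj => by unfold posBand; omega)] <;> omega
    by_cases h1 : i = 1
    · rw [cnt_eq_of_iff (a := 1) (b := r + 1) (c := k) (d := k)
        (fun j hj => by unfold posBand; omega)] <;> omega
    by_cases h2 : i = 2
    · rw [cnt_eq_of_iff (a := 2) (b := r + 1) (c := r + 2) (d := r + 3)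
        (fun j hj => by unfold posBand; omega)] <;> omega
    by_cases h3 : i = 3
    · rw [cnt_eq_of_iff (a := 0) (b := 1) (c := 3) (d := r + 2)
        (fun j hj => by unfold posBand; omega)] <;> omega
    by_cases h4 : i + r ≤ k
    · rw [cnt_eq_of_iff (a := i) (b := i + r) (c := k) (d := k)
        (fun j hj => by rw [posBand_of_four_le (by omega)]; omega)] <;> omega
    · rw [cnt_eq_of_iff (a := 0) (b := i + r - k) (c := i) (d := k)
        (fun j hj => by rw [posBand_of_four_le (by omega)]; omega)] <;> omega
  · rw [hneg j, zero_add]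
    by_cases h0 : j = 0
    · rw [cnt_eq_of_iff (a := 3) (b := 4) (c := k + 1 - r) (d := k)
        (fun i hi => by unfold posBand; omega)] <;> omega
    by_cases h1 : j = 1
    · rw [cnt_eq_of_iff (a := 0) (b := 2) (c := k + 2 - r) (d := k)
        (fun i hi => by unfold posBand; omega)] <;> omega
    by_cases h2 : j < r
    · rw [cnt_eq_of_iff (a := 0) (b := j + 1) (c := k + j + 1 - r) (d := k)
        (fun i hi => by unfold posBand; omega)] <;> omega
    by_cases h3 : j = r
    · rw [cnt_eq_of_iff (a := 1) (b := r + 1) (c := k) (d := k)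
        (fun i hi => by unfold posBand; omega)] <;> omega
    by_cases h4 : j = r + 1
    · rw [cnt_eq_of_iff (a := 0) (b := 1) (c := 3) (d := r + 2)
        (fun i hi => by unfold posBand; omega)] <;> omega
    by_cases h5 : j = r + 2
    · rw [cnt_eq_of_iff (a := 2) (b := 3) (c := 4) (d := r + 3)
        (fun i hi => by unfold posBand; omega)] <;> omega
    · rw [cnt_eq_of_iff (a := j + 1 - r) (b := j + 1) (c := k) (d := k)
        (fun i hi => by unfold posBand; omega)] <;> omega

/-- The complement of an asymmetric bipartite graph is asymmetric. -/
theorem hasAsymmetricMatrix_compl {k r : ℕ} (hrk : r ≤ k) (h : HasAsymmetricMatrix k r 0) :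
    HasAsymmetricMatrix k (k - r : ℕ) 0 := by
  obtain ⟨B, hB, hr, hc, ht, hs⟩ := h
  have hnn : ∀ i j, 0 ≤ B i j := fun i j => by
    have h1 := Finset.sum_eq_zero_iff.1 ht i (Finset.mem_univ i)
    have h2 := Finset.sum_eq_zero_iff.1 h1 j (Finset.mem_univ j)
    omega
  refine ⟨fun i j => 1 - B i j, fun i j => ?_, fun i => ?_, fun j => ?_, ?_, ?_⟩
  · have h1 := hB i j
    have h2 := hnn i j
    change 1 - B i j = 0 ∨ 1 - B i j = 1 ∨ 1 - B i j = -1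
    omega
  · rw [Finset.sum_sub_distrib, hr]; simp [Nat.cast_sub hrk]
  · rw [Finset.sum_sub_distrib, hc]; simp [Nat.cast_sub hrk]
  · refine Finset.sum_eq_zero fun i _ => Finset.sum_eq_zero fun j _ => ?_
    have h1 := hB i j
    change (-(1 - B i j)).toNat = 0
    omega
  · rw [← hs]
    congr 1
    have : matrixSymm (fun i j => 1 - B i j) = matrixSymm B := by
      ext g
      simp only [mem_matrixSymm, sub_right_inj]
    rw [this]

theorem hasAsymmetricMatrix_of_three_le {k r : ℕ} (hk : 8 ≤ k) (hr : 3 ≤ r) (hrk : r + 3 ≤ k) :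
    HasAsymmetricMatrix k r 0 := by
  by_cases h : 2 * r ≤ k
  · exact hasAsymmetricMatrix_band hk hr h
  · have := hasAsymmetricMatrix_compl (r := k - r) (by omega)
      (hasAsymmetricMatrix_band hk (by omega) (by omega))
    rwa [Nat.sub_sub_self (by omega)] at this

/-! ### The minimal orders -/

theorem matrixSymm_comp {ι κ α β : Type*} (A : ι → κ → α) {f : α → β}
    (hf : Function.Injective f) : matrixSymm (fun i j => f (A i j)) = matrixSymm A := by
  ext g
  simp only [mem_matrixSymm, hf.eq_iff]

theorem one_le_card_matrixSymm {ι κ α : Type*} [Finite ι] [Finite κ] (A : ι → κ → α) :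
    1 ≤ Nat.card (matrixSymm A) := Nat.card_pos

theorem mem_autOrders_of_asymmetric {k l q t ρ : ℕ} {ε : ℤ} (hε : ε = 1 ∨ ε = -1)
    (h : HasAsymmetricMatrix k ρ t) (hl : (l : ℤ) = q * k + ε * ρ)
    (hq : 1 ≤ q ∨ t = 0 ∧ ε = 1) :
    ρ * k + 2 * t ≤ k ^ 2 ∧
    ((q : ℤ) + ε).toNat ! ^ (ρ * k + t) * q ! ^ (k ^ 2 - ρ * k - 2 * t) *
      ((q : ℤ) - ε).toNat ! ^ t ∈ autOrders k l := by
  obtain ⟨B, hB, hr, hc, ht, h1⟩ := h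
  have hεε : ε * ε = 1 := by rcases hε with rfl | rfl <;> rfl
  have hnn : ∀ i j, 0 ≤ (q : ℤ) + ε * B i j := fun i j => by
    rcases hq with hq | ⟨rfl, rfl⟩
    · rcases hε with rfl | rfl <;> rcases hB i j with e | e | e <;> rw [e] <;> omega
    · have h2 := Finset.sum_eq_zero_iff.1 (Finset.sum_eq_zero_iff.1 ht i (Finset.mem_univ i)) j
        (Finset.mem_univ j)
      omega
  have hA : ∀ i j, (((q : ℤ) + ε * B i j).toNat : ℤ) = q + ε * B i j := fun i j =>
    Int.toNat_of_nonneg (hnn i j)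
  have hpos : ∑ i, ∑ j, (B i j).toNat = ρ * k + t := by
    have h2 : ∑ i, ∑ j, (((B i j).toNat : ℤ) - ((-B i j).toNat : ℤ)) = k * ρ := by
      rw [Finset.sum_congr rfl fun i _ => (Finset.sum_congr rfl fun j _ =>
        Int.toNat_sub_toNat_neg (B i j)).trans (hr i)]
      simp
    have h3 : ((∑ i, ∑ j, (-B i j).toNat : ℕ) : ℤ) = t := by rw [ht]
    simp only [Finset.sum_sub_distrib] at h2
    push_cast at h3
    zify
    linarith
  have hall : ∑ i, ∑ j, (1 - (B i j).natAbs) + (ρ * k + t) + t = k ^ 2 := by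
    rw [← hpos]
    conv_lhs => rw [← ht]
    simp only [← Finset.sum_add_distrib]
    have h2 : ∀ i j, 1 - (B i j).natAbs + (B i j).toNat + (-B i j).toNat = 1 := fun i j => by
      rcases hB i j with e | e | e <;> rw [e] <;> rfl
    simp [h2, sq]
  have hzero : ∑ i, ∑ j, (1 - (B i j).natAbs) = k ^ 2 - ρ * k - 2 * t := by omega
  refine ⟨by omega, mem_autOrders_iff.2
    ⟨fun i j => ((q : ℤ) + ε * B i j).toNat, fun i => ?_, fun j => ?_, ?_⟩⟩
  · zify
    simp only [hA, Finset.sum_add_distrib, ← Finset.mul_sum, hr, hl]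
    simp [mul_comm]
  · zify
    simp only [hA, Finset.sum_add_distrib, ← Finset.mul_sum, hc, hl]
    simp [mul_comm]
  · have hs : matrixSymm (fun i j => ((q : ℤ) + ε * B i j).toNat) = matrixSymm B := by
      rw [← matrixSymm_comp (fun i j => ((q : ℤ) + ε * B i j).toNat) Nat.cast_injective (β := ℤ)]
      simp only [hA]
      refine matrixSymm_comp B (f := fun b => (q : ℤ) + ε * b) fun a b hab => ?_
      have h2 : ε * a = ε * b := add_left_cancel hab
      rw [← one_mul a, ← one_mul b, ← hεε, mul_assoc, mul_assoc, h2]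
    have hf : ∀ i j, (((q : ℤ) + ε * B i j).toNat)! =
        ((q : ℤ) + ε).toNat ! ^ (B i j).toNat * q ! ^ (1 - (B i j).natAbs) *
          ((q : ℤ) - ε).toNat ! ^ (-B i j).toNat := fun i j => by
      rcases hB i j with e | e | e <;> rw [e] <;> simp [sub_eq_add_neg]
    rw [hs, h1, one_mul, ← hpos, ← hzero, ← ht]
    simp only [hf, Finset.prod_mul_distrib, Finset.prod_pow_eq_pow_sum]

theorem factorial_pow_mul_pow {q a b c : ℕ} (hq : q ≠ 0) :
    (q + 1)! ^ a * q ! ^ b * (q - 1)! ^ c * q ^ c = q ! ^ (a + b + c) * (q + 1) ^ a := by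
  have h : q ! = q * (q - 1)! := (Nat.mul_factorial_pred hq).symm
  rw [mul_assoc _ (_ ^ c), ← mul_pow _ _ c, mul_comm ((q - 1)!), ← h, Nat.factorial_succ, mul_pow]
  ring

/-- Suppose that a matrix with row and column sums `ρ` can fall short of `t` negative entries only at
the price of a factor `2` in symmetries per missing unit. Then the bound that an asymmetric matrix
with entries `q - 1`, `q`, `q + 1`, exactly `t` of them equal to `q - ε`, would attain is a lower
bound for all matrices. -/
theorem le_card_mul_prod_factorial {k l q t ρ : ℕ} {ε : ℤ} (hε : ε = 1 ∨ ε = -1)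
    (hl : (l : ℤ) = q * k + ε * ρ) (hq : q ≠ 0) (hk : ρ * k + 2 * t ≤ k ^ 2)
    (hsymm : ∀ B : Fin k → Fin k → ℤ, (∀ i, ∑ j, B i j = ρ) → (∀ j, ∑ i, B i j = ρ) →
      2 ^ (t - ∑ i, ∑ j, (-B i j).toNat) ≤ Nat.card (matrixSymm B))
    (A : Fin k → Fin k → ℕ) (hr : ∀ i, ∑ j, A i j = l) (hc : ∀ j, ∑ i, A i j = l) :
    ((q : ℤ) + ε).toNat ! ^ (ρ * k + t) * q ! ^ (k ^ 2 - ρ * k - 2 * t) *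
      ((q : ℤ) - ε).toNat ! ^ t ≤ Nat.card (matrixSymm A) * ∏ i, ∏ j, (A i j)! := by
  have hεε : ε * ε = 1 := by rcases hε with rfl | rfl <;> rfl
  have hrz : ∀ i, ∑ j, (A i j : ℤ) = l := fun i => by rw [← hr i]; push_cast; rfl
  have hcz : ∀ j, ∑ i, (A i j : ℤ) = l := fun j => by rw [← hc j]; push_cast; rfl
  have hρ : ε * ((l : ℤ) - k * q) = ρ := by
    rw [hl, show (q : ℤ) * k + ε * ρ - k * q = ε * ρ by ring, ← mul_assoc, hεε, one_mul]
  have hB := hsymm (fun i j => ε * ((A i j : ℤ) - q))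
    (fun i => by rw [← Finset.mul_sum, Finset.sum_sub_distrib, hrz]; simpa using hρ)
    (fun j => by rw [← Finset.mul_sum, Finset.sum_sub_distrib, hcz]; simpa using hρ)
  rw [matrixSymm_comp A (f := fun a => ε * ((a : ℤ) - q)) fun a b hab => by
    rcases hε with rfl | rfl <;> dsimp only at hab <;> omega] at hB
  -- excess and deficiency over `q` differ by the fixed amount `k (l - k q)`
  have hbal : ((∑ i, ∑ j, (A i j - q) : ℕ) : ℤ) - (∑ i, ∑ j, (q - A i j) : ℕ) = k * (ε * ρ) := by
    have h2 : ∀ i j, ((A i j - q : ℕ) : ℤ) - (q - A i j : ℕ) = A i j - q := fun i j => by omega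
    push_cast
    simp only [← Finset.sum_sub_distrib, h2]
    simp only [Finset.sum_sub_distrib, hrz, hl]
    simp
    ring
  have hP := prod_factorial_mul_pow_le q A
  rcases hε with rfl | rfl
  · have e1 : ∀ i j, (-(1 * ((A i j : ℤ) - q))).toNat = q - A i j := fun i j => by omega
    simp only [e1] at hB
    rw [show ((q : ℤ) + 1).toNat = q + 1 by omega, show ((q : ℤ) - 1).toNat = q - 1 by omega]
    have hbal' : ∑ i, ∑ j, (A i j - q) = ρ * k + ∑ i, ∑ j, (q - A i j) := by
      zify at hbal ⊢; linarith
    refine le_mul_of_excess hq (p₀ := ρ * k + t) (m₀ := t) ?_ hP (by omega)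
      (le_trans (Nat.pow_le_pow_right two_pos (by omega)) hB)
    rw [factorial_pow_mul_pow hq]
    congr 2; omega
  · have e1 : ∀ i j, (-(-1 * ((A i j : ℤ) - q))).toNat = A i j - q := fun i j => by omega
    simp only [e1] at hB
    rw [show ((q : ℤ) + -1).toNat = q - 1 by omega, show ((q : ℤ) - -1).toNat = q + 1 by omega]
    have hbal' : ∑ i, ∑ j, (q - A i j) = ρ * k + ∑ i, ∑ j, (A i j - q) := by
      zify at hbal ⊢; linarith
    refine le_mul_of_excess hq (p₀ := t) (m₀ := ρ * k + t) ?_ hP (by omega) hB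
    have h2 := factorial_pow_mul_pow (a := t) (b := k ^ 2 - ρ * k - 2 * t) (c := ρ * k + t) hq
    rw [show t + (k ^ 2 - ρ * k - 2 * t) + (ρ * k + t) = k ^ 2 by omega] at h2
    rw [← h2]
    ring

theorem isLeast_autOrders_of_asymmetric {k l q t ρ : ℕ} {ε : ℤ} (hε : ε = 1 ∨ ε = -1)
    (h : HasAsymmetricMatrix k ρ t) (hl : (l : ℤ) = q * k + ε * ρ)
    (hq : 1 ≤ q ∨ t = 0 ∧ ε = 1)
    (hsymm : ∀ B : Fin k → Fin k → ℤ, (∀ i, ∑ j, B i j = ρ) → (∀ j, ∑ i, B i j = ρ) →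
      2 ^ (t - ∑ i, ∑ j, (-B i j).toNat) ≤ Nat.card (matrixSymm B)) :
    IsLeast (autOrders k l) (((q : ℤ) + ε).toNat ! ^ (ρ * k + t) *
      q ! ^ (k ^ 2 - ρ * k - 2 * t) * ((q : ℤ) - ε).toNat ! ^ t) := by
  obtain ⟨hk, hmem⟩ := mem_autOrders_of_asymmetric hε h hl hq
  refine ⟨hmem, fun n hn => ?_⟩
  obtain ⟨A, hr, hc, rfl⟩ := mem_autOrders_iff.1 hn
  rcases Nat.eq_zero_or_pos q with rfl | hq0
  · obtain ⟨rfl, rfl⟩ : t = 0 ∧ ε = 1 := by omega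
    have h1 : 1 ≤ _ := Nat.mul_pos (one_le_card_matrixSymm A) (prod_factorial_pos A)
    simpa only [CharP.cast_eq_zero, zero_add, Int.toNat_one, Nat.factorial_one, one_pow,
      Nat.factorial_zero, one_mul, pow_zero, mul_one] using h1
  · exact le_card_mul_prod_factorial hε hl hq0.ne' hk hsymm A hr hc

theorem two_pow_le_card_of_sum_eq_two_int {k : ℕ} (hk : 2 ≤ k) (B : Fin k → Fin k → ℤ)
    (hr : ∀ i, ∑ j, B i j = 2) (hc : ∀ j, ∑ i, B i j = 2) :
    2 ^ (1 - ∑ i, ∑ j, (-B i j).toNat) ≤ Nat.card (matrixSymm B) := by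
  rcases Nat.eq_zero_or_pos (∑ i, ∑ j, (-B i j).toNat) with h | h
  · have hnn : ∀ i j, ((B i j).toNat : ℤ) = B i j := fun i j => by
      have h2 := Finset.sum_eq_zero_iff.1 (Finset.sum_eq_zero_iff.1 h i (Finset.mem_univ i)) j
        (Finset.mem_univ j)
      omega
    rw [h]
    have h3 := two_le_card_matrixSymm_of_sum_eq_two hk (fun i j => (B i j).toNat)
      (fun i => by zify; simp only [hnn, hr]) (fun j => by zify; simp only [hnn, hc])
    rw [← matrixSymm_comp (fun i j => (B i j).toNat) Nat.cast_injective (β := ℤ)] at h3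
    simp only [hnn] at h3
    exact h3
  · rw [Nat.sub_eq_zero_of_le h]
    exact one_le_card_matrixSymm B

/-! ### Two-regular graphs -/

open Classical in
/-- The adjacency matrix of a cycle of length `2k`. -/
noncomputable def cycleMatrix (k : ℕ) : Fin k → Fin k → ℕ := fun i j =>
  if posCycle k i j then 1 else 0

theorem sum_cycleMatrix_row {k : ℕ} (hk : 2 ≤ k) (i : Fin k) : ∑ j, cycleMatrix k i j = 2 := by
  have hi := i.2
  simp only [cycleMatrix]
  rw [sum_ite_eq_cnt k fun j => posCycle k i j]
  by_cases h : (i : ℕ) + 1 < k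
  · exact cnt_eq_two (i : ℕ) (i + 1) (by omega) h fun j hj => by unfold posCycle; omega
  · exact cnt_eq_two 0 (i : ℕ) (by omega) hi fun j hj => by unfold posCycle; omega

theorem sum_cycleMatrix_col {k : ℕ} (hk : 2 ≤ k) (j : Fin k) : ∑ i, cycleMatrix k i j = 2 := by
  have hj := j.2
  simp only [cycleMatrix]
  rw [sum_ite_eq_cnt k fun i => posCycle k i j]
  by_cases h : (j : ℕ) = 0
  · exact cnt_eq_two 0 (k - 1) (by omega) (by omega) fun i hi => by unfold posCycle; omega
  · exact cnt_eq_two ((j : ℕ) - 1) j (by omega) hj fun i hi => by unfold posCycle; omega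

/-- A symmetry of the cycle is determined by the image of one edge. -/
theorem card_matrixSymm_cycleMatrix_le {k : ℕ} (hk : 2 ≤ k) :
    Nat.card (matrixSymm (cycleMatrix k)) ≤ 2 * k := by
  classical
  have hle : ∀ i j, cycleMatrix k i j = if cycleMatrix k i j = 1 then 1 else 0 := fun i j => by
    unfold cycleMatrix; split_ifs <;> simp_all
  have hcard : Nat.card {p : Fin k × Fin k // cycleMatrix k p.1 p.2 = 1} = 2 * k := by
    rw [Nat.card_eq_fintype_card, Fintype.card_subtype, Finset.card_filter,
      Fintype.sum_prod_type]
    simp only [← hle, sum_cycleMatrix_row hk]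
    simp [mul_comm]
  rw [← hcard]
  let o : Fin k := ⟨0, by omega⟩
  have ho : cycleMatrix k o o = 1 := by simp [cycleMatrix, posCycle]
  have hsign : matrixSymm (signMatrix k (posCycle k) fun _ _ => False) =
      matrixSymm (cycleMatrix k) := by
    rw [← matrixSymm_comp (cycleMatrix k) Nat.cast_injective (β := ℤ)]
    congr 1
    ext i j
    simp only [signMatrix, cycleMatrix, if_false, Nat.cast_ite, Nat.cast_one, Nat.cast_zero]
  refine Nat.card_le_card_of_injective
    (fun g => ⟨(g.1.1 o, g.1.2 o), (g.2 o o).trans ho⟩) fun g g' hgg => ?_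
  simp only [Subtype.mk.injEq, Prod.mk.injEq] at hgg
  have hmem : (g⁻¹ * g').1 ∈ matrixSymm (signMatrix k (posCycle k) fun _ _ => False) :=
    hsign.symm ▸ (g⁻¹ * g').2
  have h := eq_of_isPatternSymm_cycle (isPatternSymm_of_mem (fun _ _ _ => id) hmem)
    (by
      have h0 := natPerm_val (g⁻¹ * g' : matrixSymm (cycleMatrix k)).1.1 o
      have h1 : (g⁻¹ * g' : matrixSymm (cycleMatrix k)).1.1 o = o := by simp [← hgg.1]
      rw [h1] at h0; exact h0)
    (by
      have h0 := natPerm_val (g⁻¹ * g' : matrixSymm (cycleMatrix k)).1.2 o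
      have h1 : (g⁻¹ * g' : matrixSymm (cycleMatrix k)).1.2 o = o := by simp [← hgg.2]
      rw [h1] at h0; exact h0)
  have h1 : g⁻¹ * g' = 1 := Subtype.ext (Prod.ext (eq_one_of_natPerm fun i hi => (h i hi).1)
    (eq_one_of_natPerm fun i hi => (h i hi).2))
  exact inv_mul_eq_one.1 h1

theorem isLeast_autOrders_two {k : ℕ} (hk : 2 ≤ k) : IsLeast (autOrders k 2) (2 * k) := by
  constructor
  · refine mem_autOrders_iff.2 ⟨cycleMatrix k, sum_cycleMatrix_row hk, sum_cycleMatrix_col hk, ?_⟩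
    have h1 : ∀ i j, (cycleMatrix k i j)! = 1 := fun i j => by
      unfold cycleMatrix; split_ifs <;> rfl
    have h2 := two_mul_le_card_of_sum_eq_two (by omega) (cycleMatrix k) (sum_cycleMatrix_row hk)
      (sum_cycleMatrix_col hk)
    have h3 := card_matrixSymm_cycleMatrix_le hk
    simp only [h1, Finset.prod_const_one, mul_one] at h2 ⊢
    omega
  · intro n hn
    obtain ⟨A, hr, hc, rfl⟩ := mem_autOrders_iff.1 hn
    exact two_mul_le_card_of_sum_eq_two (by omega) A hr hc

theorem ceil_half (k : ℕ) : ⌈(k : ℚ) / 2⌉₊ = (k + 1) / 2 := by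
  refine le_antisymm (Nat.ceil_le.2 ?_) ?_
  · rw [div_le_iff₀ two_pos]
    exact_mod_cast (show k ≤ (k + 1) / 2 * 2 by omega)
  · have h := Nat.le_ceil ((k : ℚ) / 2)
    rw [div_le_iff₀ two_pos] at h
    have h2 : k ≤ ⌈(k : ℚ) / 2⌉₊ * 2 := by exact_mod_cast h
    omega

theorem theorem1p1 (k l : ℕ) (hk : 8 ≤ k) (hl : 2 ≤ l) (q : ℕ) (r : ℤ)
    (hqr : (l : ℤ) = q * k + r) (hr₁ : -2 ≤ r) (hr₂ : r ≤ (k : ℤ) - 3) :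
    IsGreatest (autOrders k l) (k ! * l ! ^ k) ∧
    (l = 2 → IsLeast (autOrders k l) (2 * k)) ∧
    (l ≠ 2 →
      (r = 0 →
        IsLeast (autOrders k l) ((q + 1)! ^ k * q ! ^ (k ^ 2 - 2 * k) * (q - 1)! ^ k)) ∧
      (3 ≤ r →
        IsLeast (autOrders k l)
          ((q + 1)! ^ (r.toNat * k) * q ! ^ (k ^ 2 - r.toNat * k))) ∧
      (r = 1 ∨ r = -1 →
        IsLeast (autOrders k l)
          (((q : ℤ) + r).toNat ! ^ (k + ⌈(k : ℚ) / 2⌉₊)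
            * q ! ^ (k ^ 2 - k - 2 * ⌈(k : ℚ) / 2⌉₊)
            * ((q : ℤ) - r).toNat ! ^ ⌈(k : ℚ) / 2⌉₊)) ∧
      (∀ ε : ℤ, ε = 1 ∨ ε = -1 → r = 2 * ε →
        IsLeast (autOrders k l)
          (((q : ℤ) + ε).toNat ! ^ (2 * k + 1) * q ! ^ (k ^ 2 - 2 * k - 2)
            * ((q : ℤ) - ε).toNat !))) := by
  refine ⟨isGreatest_autOrders (by omega), ?_, fun hl2 => ?_⟩
  · rintro rfl
    exact isLeast_autOrders_two (by omega)
  -- for `q = 0` the degree is `r`, so `3 ≤ r` unless `l = 2`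
  have hq : r ≤ 2 → 1 ≤ q := fun hr => by
    rcases Nat.eq_zero_or_pos q with rfl | h
    · simp at hqr; omega
    · exact h
  have e1 : ((q : ℤ) + 1).toNat = q + 1 := by omega
  have e2 : ((q : ℤ) - 1).toNat = q - 1 := by omega
  refine ⟨?_, fun hr => ?_, fun hr => ?_, fun ε hε hr => ?_⟩
  · rintro rfl
    have h := isLeast_autOrders_of_asymmetric (ρ := 0) (Or.inl rfl)
      (by exact_mod_cast hasAsymmetricMatrix_zero hk) (by simpa using hqr)
      (Or.inl (hq (by norm_num)))
      (by simpa using two_pow_le_card_of_sum_eq_zero (k := k) (by omega))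
    simpa [e1, e2] using h
  · lift r to ℕ using by omega
    have h := isLeast_autOrders_of_asymmetric (ρ := r) (t := 0) (q := q) (Or.inl rfl)
      (by exact_mod_cast hasAsymmetricMatrix_of_three_le hk (by omega) (by omega))
      (by simpa using hqr) (Or.inr ⟨rfl, rfl⟩)
      (fun B _ _ => by simpa only [Nat.zero_sub, pow_zero] using one_le_card_matrixSymm B)
    simpa [e1, e2] using h
  · rw [ceil_half]
    have h := isLeast_autOrders_of_asymmetric (ρ := 1) hr
      (by exact_mod_cast hasAsymmetricMatrix_one hk) (by simpa using hqr)
      (Or.inl (hq (by omega)))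
      (by simpa using two_pow_le_card_of_sum_eq_one (k := k) (by omega))
    simpa using h
  · have h := isLeast_autOrders_of_asymmetric (ρ := 2) (t := 1) hε
      (by exact_mod_cast hasAsymmetricMatrix_two hk) (by rw [hqr, hr]; push_cast; ring)
      (Or.inl (hq (by omega)))
      (by simpa using two_pow_le_card_of_sum_eq_two_int (k := k) (by omega))
    simpa using h
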